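/- Let $D\in\mathbb N$, $\mathcal C_{\rm vol}>0$ and $D>b'>b>0$. Then there is a constant $C>0$, depending only on $D,\mathcal C_{\rm vol},b,b'$, such that the following holds. Let $\Lambda$ be (the vertex set of) a finite graph with graph distance $d$ ($d=\infty$ between different connected components), such that $|\{z: d(z,x)\le r\}|\le \mathcal C_{\rm vol}(r+1)^D$ for all $x\in\Lambda$, $r\ge 0$. Let $q\ge 1$, $\mathcal H_\Lambda=\bigotimes_{x\in\Lambda}\mathbb C^q$, $\mathcal A_\Lambda=\mathcal B(\mathcal H_\Lambda)$, and for $Z\subset\Lambda$ let $\mathcal A_Z\subset\mathcal A_\Lambda$ be the subalgebra of operators of the form $a\otimes \mathbf 1_{\Lambda\setminus Z}$. An interaction on a compact interval $I=[t_0,t_1]$, $t_0<t_1$, is a family of self-adjoint operators $\Phi(t,Z)=\Phi(t,Z)^*\in\mathcal A_Z$ ($t\in I$, $Z\subset\Lambda$); for $p>0$ put $$\|\Phi\|_p=\sup_{t\in I}\sup_{z\in\Lambda}\sum_{Z\subset\Lambda:\,z\in Z}\|\Phi(t,Z)\|\,e^{p\operatorname{diam}Z}\in[0,\infty].$$ Let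 $\Phi$ be an interaction on $I$ such that every $t\mapsto\Phi(t,Z)$ is smooth on $I$, with $\|\Phi\|_{b'}<\infty$ and $\|\dot\Phi\|_{b'}<\infty$, where $\dot\Phi(t,Z)=\partial_t\Phi(t,Z)$. Let $H(t)=\sum_{Z\subset\Lambda}\Phi(t,Z)$. For $\beta>0$ and $A\in\mathcal A_\Lambda$ let $$\mathcal I_{H(t),\beta}(A)=\int_{-\infty}^\infty \frac{\beta}{\sqrt\pi}\,e^{-\beta^2u^2}\int_0^u e^{isH(t)}\,A\,e^{-isH(t)}\,ds\,du .$$ Let $K\ge 1$ be any constant with $|Z|\,e^{-(b'-b)\operatorname{diam}Z}\le K$ for all $Z\subset\Lambda$, let $v=2K\|\Phi\|_{b'}/b$ be the corresponding Lieb–Robinson velocity, and for $\beta>0$ let $$b(\beta)=\min\Big\{\frac b2,\frac{\beta^2}{4v^2}\Big\}\quad\Big(b(\beta)=\frac b2\text{ if }v=0\Big),\qquad C(\beta)=1+C\,b(\beta)^{-(D+1)}\,(\beta+\beta^{-1}).$$ Then for every $\beta>0$ there is an interaction $\Psi_\beta$ on $I$ with $$\mathcal I_{H(t),\beta}\big(\dot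 H(t)\big)=\sum_{Z\subset\Lambda}\Psi_\beta(t,Z)\quad\text{for all }t\in I,\qquad \|\Psi_\beta\|_{b(\beta)/3}\le C(\beta)\,\|\dot\Phi\|_{b'},$$ and the last inequality is strict if $\|\dot\Phi\|_{b'}\neq 0$. -/

import Mathlib

open scoped ENNReal ContDiff
open MeasureTheory

namespace SpinLattice

noncomputable section

/-- `G` belongs to the class of graphs with parameters `D`, `Cvol`: every ball of radius `r` has at
most `Cvol * (r + 1) ^ D` elements. Graph distances are integers or infinite (between different
connected components), so integer radii suffice. -/
def InGraphClass {Λ : Type*} (G : SimpleGraph Λ) (D : ℕ) (Cvol : ℝ) : Prop :=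
  ∀ (x : Λ) (r : ℕ),
    (Set.ncard {z : Λ | G.edist z x ≤ (r : ℕ∞)} : ℝ) ≤ Cvol * ((r : ℝ) + 1) ^ D

/-- Diameter of a finite set of vertices in the (extended) graph distance; zero for `∅`. -/
def graphDiam {Λ : Type*} (G : SimpleGraph Λ) (Z : Finset Λ) : ℕ∞ :=
  Z.sup fun x => Z.sup fun y => G.edist x y

/-- The weight `exp (b * diam Z)` for `b > 0`, infinite if `diam Z = ∞`. -/
def expWeight {Λ : Type*} (G : SimpleGraph Λ) (b : ℝ) (Z : Finset Λ) : ℝ≥0∞ :=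
  if graphDiam G Z = ⊤ then ⊤ else ENNReal.ofReal (Real.exp (b * (graphDiam G Z).toNat))

/-- `K ≥ 1` and `|Z| * exp (-b * diam Z) ≤ K` for all sets of vertices `Z`
(the left-hand side is zero if `diam Z = ∞`). -/
def IsVolumeConst {Λ : Type*} (G : SimpleGraph Λ) (b K : ℝ) : Prop :=
  1 ≤ K ∧ ∀ Z : Finset Λ, graphDiam G Z ≠ ⊤ →
    (Z.card : ℝ) * Real.exp (-b * (graphDiam G Z).toNat) ≤ K

section Observables

variable (Λ : Type*) [Fintype Λ] [DecidableEq Λ] (q : ℕ)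

/-- The tensor product of `ℂ ^ q` over the sites of `Λ`, with the configurations `Λ → Fin q`
labelling its orthonormal product basis. -/
abbrev HilbertSpace : Type _ := EuclideanSpace ℂ (Λ → Fin q)

/-- The algebra of all operators on the Hilbert space, with the operator norm and the adjoint. -/
abbrev Obs : Type _ := HilbertSpace Λ q →L[ℂ] HilbertSpace Λ q

end Observables

variable {Λ : Type*} [Fintype Λ] [DecidableEq Λ] {q : ℕ}

/-- The matrix of `a ⊗ 1`, where `a` acts on the sites in `X` and `1` on all other sites. -/
def tensorOne (X : Finset Λ) (a : Matrix (X → Fin q) (X → Fin q) ℂ) :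
    Matrix (Λ → Fin q) (Λ → Fin q) ℂ :=
  Matrix.of fun σ τ =>
    if ∀ x, x ∉ X → σ x = τ x then a (fun x => σ x) (fun x => τ x) else 0

/-- The algebra of the observables supported in `X`, as a subset of the full algebra. -/
def localObs (X : Finset Λ) : Set (Obs Λ q) :=
  Set.range fun a : Matrix (X → Fin q) (X → Fin q) ℂ =>
    (Matrix.toEuclideanCLM (n := Λ → Fin q) (𝕜 := ℂ) (tensorOne X a) : Obs Λ q)

/-- `Φ` is a time-dependent interaction on the time interval `I`. -/
def IsInteraction (I : Set ℝ) (Φ : ℝ → Finset Λ → Obs Λ q) : Prop :=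
  ∀ t ∈ I, ∀ Z, Φ t Z ∈ localObs Z ∧ IsSelfAdjoint (Φ t Z)

/-- The interaction norm with decay rate `b > 0`, with values in `[0, ∞]`. -/
def interactionNorm (G : SimpleGraph Λ) (I : Set ℝ) (b : ℝ) (Φ : ℝ → Finset Λ → Obs Λ q) : ℝ≥0∞ :=
  ⨆ t ∈ I, ⨆ z : Λ, ∑ Z : Finset Λ with z ∈ Z, ‖Φ t Z‖ₑ * expWeight G b Z

/-- The operator `H(t) = ∑ Z, Φ(t, Z)` of an interaction. -/
def hamiltonian (Φ : ℝ → Finset Λ → Obs Λ q) (t : ℝ) : Obs Λ q :=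
  ∑ Z : Finset Λ, Φ t Z

/-- The interaction `(t, Z) ↦ ∂ₜ Φ(t, Z)` (one-sided derivatives at the end points of `I`). -/
def timeDeriv (I : Set ℝ) (Φ : ℝ → Finset Λ → Obs Λ q) : ℝ → Finset Λ → Obs Λ q :=
  fun t Z => derivWithin (fun s => Φ s Z) I t

/-- The Heisenberg evolution `exp (i s H) A exp (-i s H)`. -/
def heisenberg (H : Obs Λ q) (s : ℝ) (A : Obs Λ q) : Obs Λ q :=
  NormedSpace.exp ((Complex.I * (s : ℂ)) • H) * A * NormedSpace.exp (-((Complex.I * (s : ℂ)) • H))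

/-- The Gaussian filter `β / √π * exp (-β² t²)`. -/
def gaussianFilter (β t : ℝ) : ℝ :=
  β / √Real.pi * Real.exp (-(β ^ 2 * t ^ 2))

/-- The almost inverse Liouvillian
`∫ φ_β(t) ∫₀ᵗ exp (i s H) A exp (-i s H) ds dt`. -/
def almostInverseLiouvillian (H : Obs Λ q) (β : ℝ) (A : Obs Λ q) : Obs Λ q :=
  ∫ t : ℝ, gaussianFilter β t • ∫ s in (0 : ℝ)..t, heisenberg H s A

/-- The Lieb-Robinson velocity `2 K ‖Φ‖_{b'} / b`, where `N = ‖Φ‖_{b'}`. -/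
def lrVelocity (K b : ℝ) (N : ℝ≥0∞) : ℝ :=
  2 * K * N.toReal / b

/-- `min {b / 2, β² / (4 v²)}`, where the second entry is infinite if `v = 0`. -/
def decayRate (b v β : ℝ) : ℝ :=
  if v = 0 then b / 2 else min (b / 2) (β ^ 2 / (4 * v ^ 2))

/-- `C(β) = 1 + C b(β) ^ (-(D + 1)) (β + 1 / β)`, where `r = b(β)`. -/
def prefactor (C : ℝ) (D : ℕ) (r β : ℝ) : ℝ :=
  1 + C * (r ^ (D + 1))⁻¹ * (β + β⁻¹)

end

end SpinLattice

/-! The filtered evolution `J` is linear in its argument, so applied to `∂ₜH` it is a sum of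
operators `J Z`, one for each term `∂ₜΦ Z`. Each `J Z` is only quasi-local, and the work lies in
cutting it into strictly local pieces with controlled norms.

Locality comes from the Lieb-Robinson bound `lieb_robinson`. If `A` lives on `X` and `B`, with `‖B‖
≤ 1`, lives at distance more than `k` from `X`, then the commutator of the evolved `A` with `B` is
at most `2 ‖A‖ |X| exp (-b k + b v |s|)`. For `2 v |s| ≤ k` this is at most `2 ‖A‖ |X| exp (-b k /
2)`. For larger `|s|` the trivial bound `2 ‖A‖` is enough, because there `r k ≤ β² s²` with `r =
b(β)`. `le_gaussian_of_lieb_robinson` merges the two regimes into a multiple of `exp (-5/6 r k + 5/6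
β² s²)`, whose growth in `s` the Gaussian filter absorbs.

Small commutators with everything outside a set mean closeness to the normalized partial trace over
the outside, which is an average over Weyl unitaries (`norm_sub_unitaryAverage_le`). Differences of
partial traces over successive thickenings of `Z` split `J Z` into shells of norm `O(exp (-5/6 r
k))` (`IsDecaying.norm_shell_le`).

The weight `exp (r/3 · diam)` grows by at most `exp (2/3 r k)` on the `k`-th thickening, so a decay
`exp (-r k / 6)` survives. Polynomial volume growth then costs `∑ (k + 1) ^ D exp (-r k / 6)`, of
order `r ^ (-(D + 1))` by `sum_pow_mul_exp_le`. -/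

namespace SpinLattice

noncomputable section

/-! ### Heisenberg evolution and growth of commutators -/

section Evolution

variable {𝔄 : Type*} [CStarAlgebra 𝔄]

/-- The unitary group `exp (i s H)`. -/
def propagator (H : 𝔄) (s : ℝ) : 𝔄 :=
  NormedSpace.exp ((Complex.I * (s : ℂ)) • H)

/-- The Heisenberg evolution in a C⋆-algebra. -/
def evolution (H : 𝔄) (s : ℝ) (a : 𝔄) : 𝔄 :=
  NormedSpace.exp ((Complex.I * (s : ℂ)) • H) * a * NormedSpace.exp (-((Complex.I * (s : ℂ)) • H))

theorem evolution_eq (H : 𝔄) (s : ℝ) (a : 𝔄) :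
    evolution H s a = propagator H s * a * propagator H (-s) := by
  simp [evolution, propagator]

theorem propagator_mul_neg (H : 𝔄) (s : ℝ) : propagator H s * propagator H (-s) = 1 := by
  have : NormedAlgebra ℚ 𝔄 := NormedAlgebra.restrictScalars ℚ ℂ 𝔄
  rw [propagator, propagator, ← NormedSpace.exp_add_of_commute]
  · simp
  · exact ((Commute.refl H).smul_left _).smul_right _

theorem propagator_neg_mul (H : 𝔄) (s : ℝ) : propagator H (-s) * propagator H s = 1 := by
  simpa using propagator_mul_neg H (-s)

theorem star_propagator {H : 𝔄} (hH : IsSelfAdjoint H) (s : ℝ) :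
    star (propagator H s) = propagator H (-s) := by
  have : NormedAlgebra ℚ 𝔄 := NormedAlgebra.restrictScalars ℚ ℂ 𝔄
  rw [propagator, propagator, NormedSpace.star_exp, star_smul, hH.star_eq]
  simp

theorem propagator_mem_unitary {H : 𝔄} (hH : IsSelfAdjoint H) (s : ℝ) :
    propagator H s ∈ unitary 𝔄 := by
  rw [Unitary.mem_iff, star_propagator hH]
  exact ⟨propagator_neg_mul H s, propagator_mul_neg H s⟩

theorem propagator_eq (H : 𝔄) :
    propagator H = fun s : ℝ => NormedSpace.exp (s • (Complex.I • H)) := by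
  ext s
  rw [propagator, mul_comm, mul_smul, Complex.coe_smul]

theorem hasDerivAt_propagator (H : 𝔄) (s : ℝ) :
    HasDerivAt (propagator H) (propagator H s * (Complex.I • H)) s := by
  rw [propagator_eq]
  exact hasDerivAt_exp_smul_const (𝕂 := ℝ) (Complex.I • H) s

theorem hasDerivAt_propagator' (H : 𝔄) (s : ℝ) :
    HasDerivAt (propagator H) ((Complex.I • H) * propagator H s) s := by
  rw [propagator_eq]
  exact hasDerivAt_exp_smul_const' (𝕂 := ℝ) (Complex.I • H) s

theorem hasDerivAt_propagator_neg (H : 𝔄) (s : ℝ) :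
    HasDerivAt (fun s => propagator H (-s)) (-((Complex.I • H) * propagator H (-s))) s := by
  refine ((hasDerivAt_propagator' H (-s)).scomp s (hasDerivAt_neg s)).congr_deriv ?_
  rw [neg_smul, one_smul]

theorem continuous_propagator (H : 𝔄) : Continuous (propagator H) :=
  continuous_iff_continuousAt.2 fun s => (hasDerivAt_propagator H s).continuousAt

theorem continuous_evolution (H a : 𝔄) : Continuous fun s => evolution H s a := by
  simp only [evolution_eq]
  exact ((continuous_propagator H).mul continuous_const).mul
    ((continuous_propagator H).comp continuous_neg)

theorem evolution_zero (H a : 𝔄) : evolution H 0 a = a := by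
  simp [evolution]

theorem evolution_neg_left (H : 𝔄) (s : ℝ) (a : 𝔄) :
    evolution (-H) s a = evolution H (-s) a := by
  simp [evolution]

theorem evolution_evolution_neg (H : 𝔄) (s : ℝ) (a : 𝔄) :
    evolution H s (evolution H (-s) a) = a := by
  calc _ = (propagator H s * propagator H (-s)) * a *
        (propagator H s * propagator H (-s)) := by
        simp only [evolution_eq, neg_neg, mul_assoc]
    _ = a := by rw [propagator_mul_neg, one_mul, mul_one]

theorem evolution_mul (H : 𝔄) (s : ℝ) (a b : 𝔄) :
    evolution H s (a * b) = evolution H s a * evolution H s b := by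
  calc _ = propagator H s * a * 1 * b * propagator H (-s) := by
        simp only [evolution_eq, mul_assoc, one_mul]
    _ = _ := by
        rw [← propagator_neg_mul H s]
        simp only [evolution_eq, mul_assoc]

theorem evolution_sub (H : 𝔄) (s : ℝ) (a b : 𝔄) :
    evolution H s (a - b) = evolution H s a - evolution H s b := by
  simp only [evolution, mul_sub, sub_mul]

theorem evolution_sum {ι : Type*} (H : 𝔄) (s : ℝ) (S : Finset ι) (a : ι → 𝔄) :
    evolution H s (∑ i ∈ S, a i) = ∑ i ∈ S, evolution H s (a i) := by
  simp only [evolution, Finset.mul_sum, Finset.sum_mul]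

theorem norm_evolution {H : 𝔄} (hH : IsSelfAdjoint H) (s : ℝ) (a : 𝔄) :
    ‖evolution H s a‖ = ‖a‖ := by
  rw [evolution_eq, CStarRing.norm_mul_mem_unitary _ (propagator_mem_unitary hH _),
    CStarRing.norm_mem_unitary_mul _ (propagator_mem_unitary hH _)]

theorem star_evolution {H : 𝔄} (hH : IsSelfAdjoint H) (s : ℝ) (a : 𝔄) :
    star (evolution H s a) = evolution H s (star a) := by
  rw [evolution_eq, evolution_eq, star_mul, star_mul, star_propagator hH, star_propagator hH,
    neg_neg, mul_assoc]

theorem evolution_of_commute {H a : 𝔄} (h : Commute a H) (s : ℝ) : evolution H s a = a := by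
  have : NormedAlgebra ℚ 𝔄 := NormedAlgebra.restrictScalars ℚ ℂ 𝔄
  have h1 : Commute a (propagator H s) := (h.smul_right _).exp_right
  rw [evolution_eq, ← h1.eq, mul_assoc, propagator_mul_neg, mul_one]

theorem evolution_lie (H : 𝔄) (s : ℝ) (a b : 𝔄) :
    evolution H s ⁅a, b⁆ = ⁅evolution H s a, evolution H s b⁆ := by
  simp only [Ring.lie_def, evolution_sub, evolution_mul]

theorem norm_lie_evolution {H : 𝔄} (hH : IsSelfAdjoint H) (s : ℝ) (a b : 𝔄) :
    ‖⁅evolution H s a, b⁆‖ = ‖⁅a, evolution H (-s) b⁆‖ := by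
  rw [← norm_evolution hH s ⁅a, _⁆, evolution_lie, evolution_evolution_neg]

theorem norm_lie_le (a b : 𝔄) : ‖⁅a, b⁆‖ ≤ 2 * ‖a‖ * ‖b‖ := by
  rw [Ring.lie_def]
  refine (norm_sub_le _ _).trans ?_
  linarith [norm_mul_le a b, norm_mul_le b a]

/-- The evolution of a time-dependent observable. -/
theorem hasDerivAt_evolution (H : 𝔄) {c : ℝ → 𝔄} {c' : 𝔄} {s : ℝ} (hc : HasDerivAt c c' s) :
    HasDerivAt (fun s => evolution H s (c s)) (evolution H s (Complex.I • ⁅H, c s⁆ + c')) s := by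
  simp only [evolution_eq]
  refine (((hasDerivAt_propagator H s).mul hc).mul (hasDerivAt_propagator_neg H s)).congr_deriv ?_
  simp only [Ring.lie_def, smul_sub, mul_add, add_mul, mul_sub, sub_mul, mul_assoc, mul_neg,
    smul_mul_assoc, mul_smul_comm,
    Pi.mul_apply]
  abel

theorem hasDerivAt_evolution_neg (H b : 𝔄) (s : ℝ) :
    HasDerivAt (fun s => evolution H (-s) b) (-(Complex.I • ⁅H, evolution H (-s) b⁆)) s := by
  simp only [evolution_eq, neg_neg]
  refine (((hasDerivAt_propagator_neg H s).mul_const b).mul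
    (hasDerivAt_propagator H s)).congr_deriv ?_
  simp only [Ring.lie_def, smul_sub, mul_assoc, smul_mul_assoc, mul_smul_comm, neg_mul]
  abel

/-- If `a` commutes with `H - V`, then only `V` makes the commutator of the evolution of `a` with
`b` grow. -/
theorem norm_lie_evolution_le {H V a : 𝔄} (hH : IsSelfAdjoint H) (hV : IsSelfAdjoint V)
    (ha : Commute a (H - V)) (b : 𝔄) {s : ℝ} (hs : 0 ≤ s) :
    ‖⁅evolution H s a, b⁆‖ ≤ ‖⁅a, b⁆‖ + 2 * ‖a‖ * ∫ u in (0 : ℝ)..s, ‖⁅evolution H u V, b⁆‖ := by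
  have hH' : IsSelfAdjoint (H - V) := hH.sub hV
  -- Interaction picture: `a` is invariant under the evolution of `H - V`, so the commutator to
  -- bound has the norm of `⁅a, g s⁆`, while the derivative of `g` involves `V` only.
  set g : ℝ → 𝔄 := fun s => evolution (H - V) s (evolution H (-s) b) with hg
  have hderiv : ∀ u, HasDerivAt g
      (evolution (H - V) u (-(Complex.I • ⁅V, evolution H (-u) b⁆))) u := fun u => by
    refine (hasDerivAt_evolution (H - V) (hasDerivAt_evolution_neg H b u)).congr_deriv ?_
    rw [← smul_neg, ← smul_add, ← smul_neg]
    simp only [Ring.lie_def]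
    congr 2
    noncomm_ring
  have hnorm : ∀ u, ‖evolution (H - V) u (-(Complex.I • ⁅V, evolution H (-u) b⁆))‖
      = ‖⁅evolution H u V, b⁆‖ := fun u => by
    rw [norm_evolution hH', norm_neg, norm_smul, Complex.norm_I, one_mul, norm_lie_evolution hH]
  have hcont : Continuous fun u => evolution (H - V) u (-(Complex.I • ⁅V, evolution H (-u) b⁆)) := by
    simp only [evolution_eq, Ring.lie_def]
    have h1 := continuous_propagator (H - V)
    have h2 := continuous_propagator H
    fun_prop
  have hdiff : ‖g s - b‖ ≤ ∫ u in (0 : ℝ)..s, ‖⁅evolution H u V, b⁆‖ := by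
    have h1 := intervalIntegral.integral_eq_sub_of_hasDerivAt (a := 0) (b := s)
      (fun u _ => hderiv u) (hcont.intervalIntegrable _ _)
    have h2 : g 0 = b := by simp [hg, evolution_zero]
    rw [h2] at h1
    rw [← h1]
    refine (intervalIntegral.norm_integral_le_integral_norm hs).trans_eq ?_
    simp only [hnorm]
  calc ‖⁅evolution H s a, b⁆‖ = ‖⁅a, g s⁆‖ := by
        rw [norm_lie_evolution hH, ← norm_evolution hH' s, evolution_lie,
          evolution_of_commute ha]
    _ = ‖⁅a, b⁆ + ⁅a, g s - b⁆‖ := by congr 1; simp only [Ring.lie_def]; noncomm_ring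
    _ ≤ ‖⁅a, b⁆‖ + ‖⁅a, g s - b⁆‖ := norm_add_le _ _
    _ ≤ _ := by
        gcongr
        exact (norm_lie_le _ _).trans (by gcongr)

end Evolution

/-! ### Weighted Grönwall inequality -/

section Gronwall

theorem integral_mul_exp_mul (c s : ℝ) :
    ∫ u in (0 : ℝ)..s, c * Real.exp (c * u) = Real.exp (c * s) - 1 := by
  have h : ∀ u : ℝ, HasDerivAt (fun u => Real.exp (c * u)) (c * Real.exp (c * u)) u := fun u => by
    simpa [mul_comm] using ((hasDerivAt_id u).const_mul c).exp
  rw [intervalIntegral.integral_eq_sub_of_hasDerivAt (fun u _ => h u)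
    ((by fun_prop : Continuous fun u => c * Real.exp (c * u)).intervalIntegrable _ _)]
  simp

/-- A Grönwall inequality for finitely many functions, with weights. -/
theorem le_mul_exp_of_le_integral {ι : Type*} [Fintype ι] {G : ι → ℝ → ℝ} {T : ι → ι → ℝ}
    {w : ι → ℝ} {m c : ℝ} (hw : ∀ x, 0 < w x) (hT : ∀ x y, 0 ≤ T x y) (hm : 0 ≤ m) (hc : 0 ≤ c)
    (hTw : ∀ x, ∑ y, T x y * w y ≤ c * w x) (hG : ∀ x, Continuous (G x))
    (h : ∀ x s, 0 ≤ s → G x s ≤ m * w x + ∑ y, T x y * ∫ u in (0 : ℝ)..s, G y u)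
    (x : ι) {s : ℝ} (hs : 0 ≤ s) : G x s ≤ m * w x * Real.exp (c * s) := by
  -- Compactness of `[0, s]` gives an a priori bound with some error `L`. Each insertion into the
  -- integral inequality improves the error to the next term `L (c u) ^ n / n!`, which tends to
  -- zero.
  obtain ⟨L, hL0, hL⟩ : ∃ L : ℝ, 0 ≤ L ∧
      ∀ y, ∀ u ∈ Set.Icc 0 s, G y u ≤ w y * (m * Real.exp (c * u) + L) := by
    have h1 : ∀ y, ∃ L : ℝ, ∀ u ∈ Set.Icc 0 s, G y u / w y - m * Real.exp (c * u) ≤ L := fun y => by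
      have hcont : Continuous fun u => G y u / w y - m * Real.exp (c * u) := by
        have := hG y
        fun_prop
      obtain ⟨L, hL⟩ := (isCompact_Icc (a := (0 : ℝ)) (b := s)).bddAbove_image hcont.continuousOn
      exact ⟨L, fun u hu => hL (Set.mem_image_of_mem _ hu)⟩
    choose L hL using h1
    obtain ⟨M, hM⟩ := (Set.finite_range L).bddAbove
    refine ⟨max M 0, le_max_right _ _, fun y u hu => ?_⟩
    have h2 := (hL y u hu).trans ((hM (Set.mem_range_self y)).trans (le_max_left M 0))
    rw [sub_le_iff_le_add, div_le_iff₀ (hw y)] at h2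
    linarith
  have key : ∀ n : ℕ, ∀ y, ∀ u ∈ Set.Icc 0 s,
      G y u ≤ w y * (m * Real.exp (c * u) + L * ((c * u) ^ n / n.factorial)) := by
    intro n
    induction n with
    | zero => simpa using hL
    | succ n ih =>
      intro y u hu
      have hint : ∀ z, ∫ r in (0 : ℝ)..u, G z r ≤
          w z * ∫ r in (0 : ℝ)..u, (m * Real.exp (c * r) + L * ((c * r) ^ n / n.factorial)) := by
        intro z
        rw [← intervalIntegral.integral_const_mul]
        refine intervalIntegral.integral_mono_on hu.1 ((hG z).intervalIntegrable _ _)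
          (Continuous.intervalIntegrable (by fun_prop) _ _) fun r hr => ?_
        exact ih z r ⟨hr.1, hr.2.trans hu.2⟩
      have hval : c * ∫ r in (0 : ℝ)..u, (m * Real.exp (c * r) + L * ((c * r) ^ n / n.factorial))
          = m * (Real.exp (c * u) - 1) + L * ((c * u) ^ (n + 1) / (n + 1).factorial) := by
        have hd : ∀ r : ℝ, HasDerivAt
            (fun r => m * Real.exp (c * r) + L * ((c * r) ^ (n + 1) / (n + 1).factorial))
            (c * (m * Real.exp (c * r) + L * ((c * r) ^ n / n.factorial))) r := fun r => by
          have e1 := (((hasDerivAt_id r).const_mul c).exp.const_mul m)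
          have e2 := ((((hasDerivAt_id r).const_mul c).pow (n + 1)).div_const
            ((n + 1).factorial : ℝ)).const_mul L
          refine (e1.add e2).congr_deriv ?_
          rw [Nat.factorial_succ]
          have : (n.factorial : ℝ) ≠ 0 := by positivity
          push_cast
          simp only [id]
          field_simp
        rw [← intervalIntegral.integral_const_mul,
          intervalIntegral.integral_eq_sub_of_hasDerivAt (fun r _ => hd r)
            (Continuous.intervalIntegrable (by fun_prop) _ _)]
        simp
        ring
      set P := ∫ r in (0 : ℝ)..u, (m * Real.exp (c * r) + L * ((c * r) ^ n / n.factorial)) with hP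
      have hP0 : 0 ≤ P := intervalIntegral.integral_nonneg hu.1 fun r hr => by
        have := hr.1
        positivity
      calc G y u ≤ m * w y + ∑ z, T y z * ∫ r in (0 : ℝ)..u, G z r := h y u hu.1
        _ ≤ m * w y + ∑ z, T y z * (w z * P) := by
            gcongr with z
            · exact hT y z
            · exact hint z
        _ = m * w y + (∑ z, T y z * w z) * P := by
            rw [Finset.sum_mul]; simp only [mul_assoc]
        _ ≤ m * w y + c * w y * P := by gcongr; exact hTw y
        _ = w y * (m + c * P) := by ring
        _ = _ := by rw [hval]; ring
  refine ge_of_tendsto (x := Filter.atTop) (f := fun n : ℕ =>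
    w x * (m * Real.exp (c * s) + L * ((c * s) ^ n / n.factorial))) ?_
    (Filter.Eventually.of_forall fun n => key n x s ⟨hs, le_rfl⟩)
  have := (((FloorSemiring.tendsto_pow_div_factorial_atTop (c * s)).const_mul L).const_add
    (m * Real.exp (c * s))).const_mul (w x)
  convert this using 2
  ring

end Gronwall

/-! ### Lieb-Robinson bound -/

section LiebRobinson

variable {𝔄 : Type*} [CStarAlgebra 𝔄] {Λ : Type*} [Fintype Λ] [DecidableEq Λ]

/-- The sum of the interaction terms whose supports meet `X`. -/
def localPart (Φ : Finset Λ → 𝔄) (X : Finset Λ) : 𝔄 :=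
  ∑ Z : Finset Λ with ¬Disjoint X Z, Φ Z

theorem isSelfAdjoint_localPart {Φ : Finset Λ → 𝔄} (hΦ : ∀ Z, IsSelfAdjoint (Φ Z))
    (X : Finset Λ) : IsSelfAdjoint (localPart Φ X) :=
  isSelfAdjoint_sum _ fun Z _ => hΦ Z

theorem sum_not_disjoint_le {f : Finset Λ → ℝ} (hf : ∀ Z, 0 ≤ f Z) (X : Finset Λ) :
    ∑ Z : Finset Λ with ¬Disjoint X Z, f Z ≤ ∑ x ∈ X, ∑ Z : Finset Λ with x ∈ Z, f Z := by
  simp only [Finset.sum_filter]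
  rw [Finset.sum_comm]
  refine Finset.sum_le_sum fun Z _ => ?_
  have h0 : ∀ x ∈ X, 0 ≤ if x ∈ Z then f Z else 0 := fun x _ => by
    split_ifs
    exacts [hf Z, le_rfl]
  split_ifs with h
  · exact Finset.sum_nonneg h0
  · obtain ⟨x, hx, hxZ⟩ := Finset.not_disjoint_iff.1 h
    refine le_trans ?_ (Finset.single_le_sum h0 hx)
    simp [hxZ]

theorem lie_localPart_le {Φ : Finset Λ → 𝔄} (H b : 𝔄) (X : Finset Λ) (s : ℝ) :
    ‖⁅evolution H s (localPart Φ X), b⁆‖ ≤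
      ∑ x ∈ X, ∑ Z : Finset Λ with x ∈ Z, ‖⁅evolution H s (Φ Z), b⁆‖ := by
  refine le_trans ?_ (sum_not_disjoint_le (fun Z => norm_nonneg ⁅evolution H s (Φ Z), b⁆) X)
  rw [localPart, evolution_sum, Ring.lie_def, Finset.sum_mul, Finset.mul_sum,
    ← Finset.sum_sub_distrib]
  exact norm_sum_le _ _

theorem continuous_norm_lie_evolution (H a b : 𝔄) :
    Continuous fun s => ‖⁅evolution H s a, b⁆‖ := by
  simp only [Ring.lie_def]
  have := continuous_evolution H a
  fun_prop

/-- The growth of commutators, site by site. -/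
theorem norm_lie_evolution_le_sum {Φ : Finset Λ → 𝔄} (hsa : ∀ Z, IsSelfAdjoint (Φ Z))
    {X : Finset Λ} {a : 𝔄} (ha : ∀ Z, Disjoint X Z → Commute a (Φ Z)) (b : 𝔄) {s : ℝ}
    (hs : 0 ≤ s) :
    ‖⁅evolution (∑ Z, Φ Z) s a, b⁆‖ ≤ ‖⁅a, b⁆‖ + 2 * ‖a‖ * ∑ x ∈ X, ∫ u in (0 : ℝ)..s,
      ∑ Z : Finset Λ with x ∈ Z, ‖⁅evolution (∑ Z, Φ Z) u (Φ Z), b⁆‖ := by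
  have hcont := fun Z => continuous_norm_lie_evolution (∑ Z, Φ Z) (Φ Z) b
  have hcomm : Commute a (∑ Z, Φ Z - localPart Φ X) := by
    rw [localPart, ← Finset.sum_filter_add_sum_filter_not Finset.univ (fun Z => Disjoint X Z) Φ,
      add_sub_cancel_right]
    exact Commute.sum_right _ _ _ fun Z hZ => ha Z (Finset.mem_filter.1 hZ).2
  refine (norm_lie_evolution_le (isSelfAdjoint_sum _ fun Z _ => hsa Z)
    (isSelfAdjoint_localPart hsa X) hcomm b hs).trans ?_
  gcongr
  rw [← intervalIntegral.integral_finsetSum fun x _ => Continuous.intervalIntegrable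
    (continuous_finsetSum _ fun Z _ => hcont Z) _ _]
  refine intervalIntegral.integral_mono_on hs
    ((continuous_norm_lie_evolution _ _ b).intervalIntegrable _ _)
    (Continuous.intervalIntegrable (continuous_finsetSum _ fun x _ =>
      continuous_finsetSum _ fun Z _ => hcont Z) _ _) fun u _ => ?_
  exact lie_localPart_le _ b X u

/-- The Lieb-Robinson bound for an interaction whose terms decay with respect to a weight `w`. -/
theorem lieb_robinson {Φ : Finset Λ → 𝔄} (hsa : ∀ Z, IsSelfAdjoint (Φ Z))
    (hΦ : ∀ Z Z', Disjoint Z Z' → Commute (Φ Z) (Φ Z')) {w : Λ → ℝ} (hw : ∀ x, 0 < w x)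
    {κ : ℝ} (hκ : 0 ≤ κ)
    (hwΦ : ∀ x, ∑ Z : Finset Λ with x ∈ Z, ‖Φ Z‖ * ∑ y ∈ Z, w y ≤ κ * w x)
    {Y : Finset Λ} {b : 𝔄} (hY : ∀ y ∈ Y, 1 ≤ w y) (hb : ∀ Z, Disjoint Z Y → Commute (Φ Z) b)
    {X : Finset Λ} {a : 𝔄} (ha : ∀ Z, Disjoint X Z → Commute a (Φ Z)) (hab : Commute a b)
    {s : ℝ} (hs : 0 ≤ s) :
    ‖⁅evolution (∑ Z, Φ Z) s a, b⁆‖ ≤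
      2 * ‖a‖ * ‖b‖ * (∑ x ∈ X, w x) * (Real.exp (2 * κ * s) - 1) := by
  set H := ∑ Z, Φ Z with hH
  set G : Λ → ℝ → ℝ := fun x s => ∑ Z : Finset Λ with x ∈ Z, ‖⁅evolution H s (Φ Z), b⁆‖ with hG
  have hGc : ∀ x, Continuous (G x) := fun x =>
    continuous_finsetSum _ fun Z _ => continuous_norm_lie_evolution H (Φ Z) b
  -- At time zero only the terms meeting `Y` contribute, and for these `∑ y ∈ Z, w y ≥ 1` because `w
  -- ≥ 1` on `Y`.
  have hinit : ∀ Z, ‖⁅Φ Z, b⁆‖ ≤ 2 * ‖b‖ * (‖Φ Z‖ * ∑ y ∈ Z, w y) := fun Z => by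
    by_cases hZ : Disjoint Z Y
    · rw [Ring.lie_def, (hb Z hZ).eq, sub_self, norm_zero]
      have := Finset.sum_nonneg fun y (_ : y ∈ Z) => (hw y).le
      positivity
    · obtain ⟨y, hyZ, hyY⟩ := Finset.not_disjoint_iff.1 hZ
      have h1 : 1 ≤ ∑ y ∈ Z, w y :=
        (hY y hyY).trans (Finset.single_le_sum (fun y _ => (hw y).le) hyZ)
      calc ‖⁅Φ Z, b⁆‖ ≤ 2 * ‖b‖ * (‖Φ Z‖ * 1) := by linarith [norm_lie_le (Φ Z) b]
        _ ≤ _ := by gcongr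
  -- `T x y` weighs the terms that contain both `x` and `y`; it is the kernel of the closed system
  -- of integral inequalities for `G`. By `hwΦ`, applying `T` to `w` costs at most a factor `2 κ`,
  -- as the Grönwall inequality requires.
  set T : Λ → Λ → ℝ := fun x y =>
    ∑ Z : Finset Λ with x ∈ Z, 2 * ‖Φ Z‖ * (if y ∈ Z then 1 else 0) with hT
  have hT0 : ∀ x y, 0 ≤ T x y := fun x y => Finset.sum_nonneg fun Z _ => by positivity
  have hTsum : ∀ x (f : Λ → ℝ), ∑ y, T x y * f y =
      ∑ Z : Finset Λ with x ∈ Z, 2 * ‖Φ Z‖ * ∑ y ∈ Z, f y := fun x f => by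
    simp only [hT, Finset.sum_mul]
    rw [Finset.sum_comm]
    refine Finset.sum_congr rfl fun Z _ => ?_
    rw [Finset.mul_sum, ← Finset.sum_filter_add_sum_filter_not Finset.univ (fun y => y ∈ Z)]
    have h2 : ∑ y with y ∉ Z, 2 * ‖Φ Z‖ * (if y ∈ Z then 1 else 0) * f y = 0 :=
      Finset.sum_eq_zero fun y hy => by simp [(Finset.mem_filter.1 hy).2]
    rw [h2, add_zero, Finset.filter_univ_mem]
    exact Finset.sum_congr rfl fun y hy => by simp [hy]
  have hTw : ∀ x, ∑ y, T x y * w y ≤ 2 * κ * w x := fun x => by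
    rw [hTsum]
    have := hwΦ x
    simp only [mul_assoc, ← Finset.mul_sum]
    linarith
  have hbound : ∀ x u, 0 ≤ u → G x u ≤ 2 * ‖b‖ * κ * w x * Real.exp (2 * κ * u) :=
    fun x u hu => by
      refine le_mul_exp_of_le_integral hw hT0 (by positivity) (by positivity) hTw hGc ?_ x hu
      intro x r hr
      rw [hTsum]
      calc G x r ≤ ∑ Z : Finset Λ with x ∈ Z, (2 * ‖b‖ * (‖Φ Z‖ * ∑ y ∈ Z, w y) +
            2 * ‖Φ Z‖ * ∑ y ∈ Z, ∫ u in (0 : ℝ)..r, G y u) := by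
            refine Finset.sum_le_sum fun Z _ => ?_
            refine (norm_lie_evolution_le_sum hsa (hΦ Z) b hr).trans ?_
            gcongr
            exact hinit Z
        _ ≤ _ := by
            rw [Finset.sum_add_distrib, ← Finset.mul_sum, mul_assoc (2 * ‖b‖) κ]
            exact add_le_add_left (mul_le_mul_of_nonneg_left (hwΦ x) (by positivity)) _
  calc ‖⁅evolution H s a, b⁆‖
      ≤ ‖⁅a, b⁆‖ + 2 * ‖a‖ * ∑ x ∈ X, ∫ u in (0 : ℝ)..s, G x u :=
        norm_lie_evolution_le_sum hsa ha b hs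
    _ = 2 * ‖a‖ * ∑ x ∈ X, ∫ u in (0 : ℝ)..s, G x u := by
        rw [Ring.lie_def, hab.eq, sub_self, norm_zero, zero_add]
    _ ≤ 2 * ‖a‖ * ∑ x ∈ X, ∫ u in (0 : ℝ)..s,
          ‖b‖ * w x * (2 * κ * Real.exp (2 * κ * u)) := by
        gcongr with x hx
        refine intervalIntegral.integral_mono_on hs ((hGc x).intervalIntegrable _ _)
          (Continuous.intervalIntegrable (by fun_prop) _ _) fun u hu => ?_
        linarith [hbound x u hu.1]
    _ = _ := by
        simp only [intervalIntegral.integral_const_mul]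
        have h3 := integral_mul_exp_mul (2 * κ) s
        rw [intervalIntegral.integral_const_mul] at h3
        rw [h3, ← Finset.sum_mul, ← Finset.mul_sum]
        ring

end LiebRobinson

/-! ### Gaussian filter -/

section Filter

variable {𝔄 : Type*} [CStarAlgebra 𝔄]

theorem gaussianFilter_nonneg {β : ℝ} (hβ : 0 < β) (t : ℝ) : 0 ≤ gaussianFilter β t := by
  unfold gaussianFilter
  positivity

theorem continuous_gaussianFilter (β : ℝ) : Continuous (gaussianFilter β) := by
  unfold gaussianFilter
  fun_prop

theorem integrable_abs_mul_exp {c : ℝ} (hc : 0 < c) :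
    Integrable fun t : ℝ => |t| * Real.exp (-c * t ^ 2) := by
  simpa [abs_mul] using (integrable_mul_exp_neg_mul_sq hc).abs

theorem integral_abs_mul_exp {c : ℝ} (hc : 0 < c) :
    ∫ t : ℝ, |t| * Real.exp (-c * t ^ 2) = c⁻¹ := by
  have h1 := integral_comp_abs (f := fun t => t * Real.exp (-c * t ^ 2))
  simp only [sq_abs] at h1
  rw [h1]
  have h2 := integral_mul_cexp_neg_mul_sq (b := (c : ℂ)) (by simpa using hc)
  have h3 : ∫ r : ℝ in Set.Ioi 0, ((r * Real.exp (-c * r ^ 2) : ℝ) : ℂ) = ((2 * c)⁻¹ : ℝ) := by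
    push_cast
    exact h2
  rw [integral_complex_ofReal, Complex.ofReal_inj] at h3
  rw [h3]
  field_simp

/-- The weighted filter function, without its normalization. -/
theorem gaussianFilter_mul_abs_mul_exp (β c C t : ℝ) :
    gaussianFilter β t * (|t| * (C * Real.exp (c * t ^ 2))) =
      C * (β / √Real.pi) * (|t| * Real.exp (-(β ^ 2 - c) * t ^ 2)) := by
  rw [gaussianFilter, show -(β ^ 2 - c) * t ^ 2 = -(β ^ 2 * t ^ 2) + c * t ^ 2 by ring,
    Real.exp_add]
  ring

theorem norm_intervalIntegral_le {f : ℝ → 𝔄} {c C : ℝ} (hc : 0 ≤ c) (hC : 0 ≤ C)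
    (hfC : ∀ s, ‖f s‖ ≤ C * Real.exp (c * s ^ 2)) (t : ℝ) :
    ‖∫ s in (0 : ℝ)..t, f s‖ ≤ |t| * (C * Real.exp (c * t ^ 2)) := by
  rw [mul_comm]
  convert intervalIntegral.norm_integral_le_of_norm_le_const (a := 0) (b := t)
    (C := C * Real.exp (c * t ^ 2)) fun s hs => (hfC s).trans ?_ using 2
  · simp
  · have h1 : |s| ≤ |t| := by
      have := Set.uIoc_subset_uIcc hs
      simpa using Set.abs_sub_left_of_mem_uIcc this
    have h2 : s ^ 2 ≤ t ^ 2 := sq_le_sq.2 h1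
    gcongr

theorem integrable_filter {f : ℝ → 𝔄} (hf : Continuous f) {β c C : ℝ} (hβ : 0 < β) (hc : 0 ≤ c)
    (hcβ : c < β ^ 2) (hC : 0 ≤ C) (hfC : ∀ s, ‖f s‖ ≤ C * Real.exp (c * s ^ 2)) :
    Integrable fun t : ℝ => gaussianFilter β t • ∫ s in (0 : ℝ)..t, f s := by
  have hcont : Continuous fun t : ℝ => gaussianFilter β t • ∫ s in (0 : ℝ)..t, f s :=
    (continuous_gaussianFilter β).smul
      (intervalIntegral.continuous_primitive (fun a b => hf.intervalIntegrable a b) 0)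
  refine Integrable.mono' (((integrable_abs_mul_exp (sub_pos.2 hcβ)).const_mul
    (C * (β / √Real.pi)))) hcont.aestronglyMeasurable (Filter.Eventually.of_forall fun t => ?_)
  rw [← gaussianFilter_mul_abs_mul_exp, norm_smul, Real.norm_of_nonneg (gaussianFilter_nonneg hβ t)]
  exact mul_le_mul_of_nonneg_left (norm_intervalIntegral_le hc hC hfC t)
    (gaussianFilter_nonneg hβ t)

/-- The majorant increases with `|s|`, so the inner integral is at most `|t|` times its value at
`t`. What remains is the first absolute moment of a Gaussian with exponent `β² - c > 0`. -/
theorem norm_filter_le {f : ℝ → 𝔄} {β c C : ℝ} (hβ : 0 < β) (hc : 0 ≤ c)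
    (hcβ : c < β ^ 2) (hC : 0 ≤ C) (hfC : ∀ s, ‖f s‖ ≤ C * Real.exp (c * s ^ 2)) :
    ‖∫ t : ℝ, gaussianFilter β t • ∫ s in (0 : ℝ)..t, f s‖ ≤
      C * (β / √Real.pi) * (β ^ 2 - c)⁻¹ := by
  rw [← integral_abs_mul_exp (sub_pos.2 hcβ), ← integral_const_mul]
  refine norm_integral_le_of_norm_le ((integrable_abs_mul_exp (sub_pos.2 hcβ)).const_mul _)
    (Filter.Eventually.of_forall fun t => ?_)
  rw [← gaussianFilter_mul_abs_mul_exp, norm_smul, Real.norm_of_nonneg (gaussianFilter_nonneg hβ t)]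
  exact mul_le_mul_of_nonneg_left (norm_intervalIntegral_le hc hC hfC t)
    (gaussianFilter_nonneg hβ t)

/-- The almost inverse Liouvillian in a C⋆-algebra. -/
def filteredEvolution (H : 𝔄) (β : ℝ) (a : 𝔄) : 𝔄 :=
  ∫ t : ℝ, gaussianFilter β t • ∫ s in (0 : ℝ)..t, evolution H s a

theorem norm_evolution_le_exp {H : 𝔄} (hH : IsSelfAdjoint H) (a : 𝔄) (s : ℝ) :
    ‖evolution H s a‖ ≤ ‖a‖ * Real.exp (0 * s ^ 2) := by
  simp [norm_evolution hH]

theorem integrable_filteredEvolution {H : 𝔄} (hH : IsSelfAdjoint H) {β : ℝ} (hβ : 0 < β) (a : 𝔄) :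
    Integrable fun t : ℝ => gaussianFilter β t • ∫ s in (0 : ℝ)..t, evolution H s a :=
  integrable_filter (continuous_evolution H a) hβ le_rfl (by positivity) (norm_nonneg a)
    (norm_evolution_le_exp hH a)

theorem norm_filteredEvolution_le {H : 𝔄} (hH : IsSelfAdjoint H) {β : ℝ} (hβ : 0 < β) (a : 𝔄) :
    ‖filteredEvolution H β a‖ ≤ ‖a‖ * (β / √Real.pi) * (β ^ 2 - 0)⁻¹ :=
  norm_filter_le hβ le_rfl (by positivity) (norm_nonneg a) (norm_evolution_le_exp hH a)

/-- Real linearity is the right generality: the lemma serves both for commutators and for the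
conjugate-linear `star`. -/
theorem map_filteredEvolution {H : 𝔄} (hH : IsSelfAdjoint H) {β : ℝ} (hβ : 0 < β) (a : 𝔄)
    (L : 𝔄 →L[ℝ] 𝔄) :
    L (filteredEvolution H β a) =
      ∫ t : ℝ, gaussianFilter β t • ∫ s in (0 : ℝ)..t, L (evolution H s a) := by
  rw [filteredEvolution, ← L.integral_comp_comm (integrable_filteredEvolution hH hβ a)]
  congr 1
  ext t
  rw [map_smul, L.intervalIntegral_comp_comm
    ((continuous_evolution H a).intervalIntegrable _ _)]

theorem filteredEvolution_sum {ι : Type*} {H : 𝔄} (hH : IsSelfAdjoint H) {β : ℝ} (hβ : 0 < β)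
    (S : Finset ι) (a : ι → 𝔄) :
    filteredEvolution H β (∑ i ∈ S, a i) = ∑ i ∈ S, filteredEvolution H β (a i) := by
  simp only [filteredEvolution]
  rw [← integral_finsetSum _ fun i _ => integrable_filteredEvolution hH hβ (a i)]
  congr 1
  ext t
  simp only [evolution_sum]
  rw [intervalIntegral.integral_finsetSum fun i _ =>
    (continuous_evolution H (a i)).intervalIntegrable _ _, Finset.smul_sum]

theorem isSelfAdjoint_filteredEvolution {H a : 𝔄} (hH : IsSelfAdjoint H) (ha : IsSelfAdjoint a)
    {β : ℝ} (hβ : 0 < β) : IsSelfAdjoint (filteredEvolution H β a) := by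
  have h := map_filteredEvolution hH hβ a ((starL' ℝ : 𝔄 ≃L[ℝ] 𝔄) : 𝔄 →L[ℝ] 𝔄)
  have h2 : ∀ x : 𝔄, ((starL' ℝ : 𝔄 ≃L[ℝ] 𝔄) : 𝔄 →L[ℝ] 𝔄) x = star x := fun x => rfl
  simp only [h2, star_evolution hH, ha.star_eq] at h
  exact h

/-- The commutator with `b`, as a bounded operator. -/
def lieRight (b : 𝔄) : 𝔄 →L[ℝ] 𝔄 :=
  (ContinuousLinearMap.mul ℝ 𝔄).flip b - ContinuousLinearMap.mul ℝ 𝔄 b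

theorem lieRight_apply (a b : 𝔄) : lieRight b a = ⁅a, b⁆ := by
  simp [lieRight, Ring.lie_def]

theorem norm_lie_filteredEvolution_le {H : 𝔄} (hH : IsSelfAdjoint H) {β c C : ℝ} (hβ : 0 < β)
    (hc : 0 ≤ c) (hcβ : c < β ^ 2) (hC : 0 ≤ C) {a b : 𝔄}
    (h : ∀ s, ‖⁅evolution H s a, b⁆‖ ≤ C * Real.exp (c * s ^ 2)) :
    ‖⁅filteredEvolution H β a, b⁆‖ ≤ C * (β / √Real.pi) * (β ^ 2 - c)⁻¹ := by
  rw [← lieRight_apply, map_filteredEvolution hH hβ]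
  exact norm_filter_le hβ hc hcβ hC fun s => by rw [lieRight_apply]; exact h s

/-- The Lieb-Robinson bound for small times and the trivial bound for large times. -/
theorem le_gaussian_of_lieb_robinson {A n B r β k σ : ℝ} (hA : 0 ≤ A) (hn : 0 ≤ n) (hB : 0 ≤ B)
    (hr : 0 ≤ r) (hk : 0 ≤ k) (h : ∀ u, 0 ≤ u → k < 2 * σ * u → r * k ≤ β ^ 2 * u ^ 2)
    (hrB : r * k ≤ B * k / 2) {x u : ℝ} (hu : 0 ≤ u) (hx1 : x ≤ A)
    (hx2 : x ≤ A * n * Real.exp (-(B * k) + B * σ * u)) :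
    x ≤ A * (n + 1) * Real.exp (-(5 / 6 * (r * k))) * Real.exp (5 / 6 * β ^ 2 * u ^ 2) := by
  have hrk : 0 ≤ r * k := by positivity
  rw [mul_assoc, ← Real.exp_add]
  -- Before twice the light-cone condition fails, half of `B k` is left and dominates `r k`.
  -- Afterwards `r k ≤ β² u²`, so the exponential on the right is at least one.
  rcases le_or_gt (2 * σ * u) k with hu1 | hu1
  · refine hx2.trans ?_
    have h1 : B * (2 * σ * u) ≤ B * k := by gcongr
    have h2 : 0 ≤ 5 / 6 * β ^ 2 * u ^ 2 := by positivity
    have h3 : A * n ≤ A * (n + 1) := by gcongr; linarith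
    exact mul_le_mul h3 (Real.exp_le_exp.2 (by linarith)) (by positivity) (by positivity)
  · have h1 := h u hu hu1
    have h2 : 1 ≤ Real.exp (-(5 / 6 * (r * k)) + 5 / 6 * β ^ 2 * u ^ 2) :=
      Real.one_le_exp (by linarith)
    calc x ≤ A * 1 * 1 := by linarith
      _ ≤ _ := by
        gcongr
        linarith

end Filter

/-! ### Averages over unitaries -/

section UnitaryAverage

variable {𝔄 : Type*} [CStarAlgebra 𝔄] {ι : Type*} [Fintype ι]

/-- The average of the conjugates of `a` by finitely many elements. -/
def unitaryAverage (U : ι → 𝔄) (a : 𝔄) : 𝔄 :=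
  (Fintype.card ι : ℂ)⁻¹ • ∑ i, U i * a * star (U i)

/-- `unitaryAverage` as a bounded operator. -/
def unitaryAverageCLM (U : ι → 𝔄) : 𝔄 →L[ℝ] 𝔄 where
  toFun := unitaryAverage U
  map_add' a b := by
    simp [unitaryAverage, mul_add, add_mul, Finset.sum_add_distrib]
  map_smul' c a := by
    simp only [unitaryAverage, mul_smul_comm, smul_mul_assoc, RingHom.id_apply,
      ← Finset.smul_sum]
    rw [smul_comm]
  cont := by
    unfold unitaryAverage
    fun_prop

theorem star_unitaryAverage (U : ι → 𝔄) (a : 𝔄) :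
    star (unitaryAverage U a) = unitaryAverage U (star a) := by
  simp [unitaryAverage, star_sum, mul_assoc]

variable [Nonempty ι] {U : ι → 𝔄}

theorem norm_unitaryAverage_le (hU : ∀ i, U i ∈ unitary 𝔄) (a : 𝔄) :
    ‖unitaryAverage U a‖ ≤ ‖a‖ := by
  have h : ‖∑ i, U i * a * star (U i)‖ ≤ Fintype.card ι * ‖a‖ := by
    refine (norm_sum_le _ _).trans_eq ?_
    rw [Finset.sum_congr rfl fun i _ => by
      rw [CStarRing.norm_mul_mem_unitary _ (Unitary.star_mem (hU i)),
        CStarRing.norm_mem_unitary_mul _ (hU i)]]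
    simp
  have hc : (0 : ℝ) < Fintype.card ι := by exact_mod_cast Fintype.card_pos
  rw [unitaryAverage, norm_smul, norm_inv, Complex.norm_natCast, inv_mul_le_iff₀ hc]
  exact h

theorem card_smul_eq (a : 𝔄) : a = (Fintype.card ι : ℂ)⁻¹ • ∑ _i : ι, a := by
  have hc : (Fintype.card ι : ℂ) ≠ 0 := by exact_mod_cast Fintype.card_ne_zero
  rw [Finset.sum_const, Finset.card_univ, ← Nat.cast_smul_eq_nsmul ℂ, smul_smul,
    inv_mul_cancel₀ hc, one_smul]

/-- For unitary `U` one has `a - U a U⋆ = ⁅a, U⁆ U⋆`, so the difference is an average of operators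
of norm at most `C`. -/
theorem norm_sub_unitaryAverage_le (hU : ∀ i, U i ∈ unitary 𝔄) {a : 𝔄} {C : ℝ}
    (h : ∀ i, ‖⁅a, U i⁆‖ ≤ C) : ‖a - unitaryAverage U a‖ ≤ C := by
  have hc : (0 : ℝ) < Fintype.card ι := by exact_mod_cast Fintype.card_pos
  have h1 : a - unitaryAverage U a
      = (Fintype.card ι : ℂ)⁻¹ • ∑ i, ⁅a, U i⁆ * star (U i) := by
    nth_rw 1 [card_smul_eq (ι := ι) a]
    rw [unitaryAverage, ← smul_sub, ← Finset.sum_sub_distrib]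
    congr 1
    refine Finset.sum_congr rfl fun i _ => ?_
    rw [Ring.lie_def, sub_mul, mul_assoc a, Unitary.mul_star_self_of_mem (hU i), mul_one]
  rw [h1, norm_smul, norm_inv, Complex.norm_natCast, inv_mul_le_iff₀ hc]
  refine (norm_sum_le _ _).trans ((Finset.sum_le_card_nsmul _ _ C fun i _ => ?_).trans_eq ?_)
  · rw [CStarRing.norm_mul_mem_unitary _ (Unitary.star_mem (hU i))]
    exact h i
  · simp

theorem unitaryAverage_of_commute (hU : ∀ i, U i ∈ unitary 𝔄) {a : 𝔄}
    (h : ∀ i, Commute a (U i)) : unitaryAverage U a = a := by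
  have h1 : ‖a - unitaryAverage U a‖ ≤ 0 := norm_sub_unitaryAverage_le hU fun i => by
    rw [Ring.lie_def, (h i).eq, sub_self, norm_zero]
  exact (sub_eq_zero.1 (norm_le_zero_iff.1 h1)).symm

end UnitaryAverage

/-! ### Local observables, Weyl operators and the partial trace -/

section Locality

variable {Λ : Type*} [DecidableEq Λ] {q : ℕ}

/-- The configuration that agrees with `σ` outside of `Y` and vanishes on `Y`. -/
def offPart [NeZero q] (Y : Finset Λ) (σ : Λ → Fin q) : Λ → Fin q :=
  Y.piecewise 0 σ

theorem offPart_of_mem [NeZero q] {Y : Finset Λ} {x : Λ} (hx : x ∈ Y) (σ : Λ → Fin q) :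
    offPart Y σ x = 0 := by
  simp [offPart, hx]

theorem offPart_of_notMem [NeZero q] {Y : Finset Λ} {x : Λ} (hx : x ∉ Y) (σ : Λ → Fin q) :
    offPart Y σ x = σ x := by
  simp [offPart, hx]

theorem offPart_eq_iff [NeZero q] {Y : Finset Λ} {σ τ : Λ → Fin q} :
    offPart Y σ = offPart Y τ ↔ ∀ x, x ∉ Y → σ x = τ x := by
  refine ⟨fun h x hx => ?_, fun h => funext fun x => ?_⟩
  · simpa [offPart_of_notMem hx] using congrFun h x
  · by_cases hx : x ∈ Y
    · rw [offPart_of_mem hx, offPart_of_mem hx]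
    · rw [offPart_of_notMem hx, offPart_of_notMem hx, h x hx]

variable [Fintype Λ]

/-- The matrix `M` acts only on the sites in `X`. -/
def IsLocalMatrix (X : Finset Λ) (M : Matrix (Λ → Fin q) (Λ → Fin q) ℂ) : Prop :=
  ∀ σ τ ρ, M σ τ = if ∀ x, x ∉ X → σ x = τ x then M (X.piecewise σ ρ) (X.piecewise τ ρ) else 0

theorem isLocalMatrix_tensorOne (X : Finset Λ) (a : Matrix (X → Fin q) (X → Fin q) ℂ) :
    IsLocalMatrix X (tensorOne X a) := by
  intro σ τ ρ
  simp only [tensorOne, Matrix.of_apply]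
  refine if_congr Iff.rfl ?_ rfl
  rw [if_pos fun x hx => by simp [hx]]
  congr 1 <;> ext x <;> simp

theorem IsLocalMatrix.exists_eq [NeZero q] {X : Finset Λ}
    {M : Matrix (Λ → Fin q) (Λ → Fin q) ℂ} (hM : IsLocalMatrix X M) :
    ∃ a, tensorOne X a = M := by
  let e : (X → Fin q) → Λ → Fin q := fun σ x => if h : x ∈ X then σ ⟨x, h⟩ else 0
  refine ⟨Matrix.of fun σ τ => M (e σ) (e τ), ?_⟩
  have he : ∀ σ : Λ → Fin q, e (fun x => σ x) = X.piecewise σ 0 := fun σ => by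
    ext x
    by_cases hx : x ∈ X <;> simp [e, hx]
  ext σ τ
  rw [hM σ τ 0]
  simp only [tensorOne, Matrix.of_apply, he]

/-- In each entry of either product a single intermediate configuration survives: it copies one
index on `X` and the other off `X`. -/
theorem IsLocalMatrix.mul_comm_of_disjoint {X Y : Finset Λ} (hXY : Disjoint X Y)
    {M N : Matrix (Λ → Fin q) (Λ → Fin q) ℂ} (hM : IsLocalMatrix X M) (hN : IsLocalMatrix Y N) :
    M * N = N * M := by
  have hYX : ∀ x ∈ Y, x ∉ X := fun x hy hx => Finset.disjoint_left.1 hXY hx hy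
  ext σ ρ
  rw [Matrix.mul_apply, Matrix.mul_apply, Finset.sum_eq_single (X.piecewise ρ σ),
    Finset.sum_eq_single (X.piecewise σ ρ)]
  · rw [hM σ (X.piecewise ρ σ) ρ, if_pos fun x hx => by simp [hx],
      hN (X.piecewise ρ σ) ρ ρ, hN σ (X.piecewise σ ρ) ρ, mul_comm]
    have h1 : X.piecewise (X.piecewise ρ σ) ρ = ρ := by
      ext x; by_cases hx : x ∈ X <;> simp [hx]
    have h2 : Y.piecewise (X.piecewise ρ σ) ρ = Y.piecewise σ ρ := by
      ext x; by_cases hx : x ∈ Y <;> simp [hx, hYX]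
    have h3 : Y.piecewise (X.piecewise σ ρ) ρ = Y.piecewise ρ ρ := by
      ext x; by_cases hx : x ∈ Y <;> simp [hx, hYX]
    rw [h1, h2, h3]
    congr 1
    refine if_congr (forall_congr' fun x => imp_congr_right fun _ => ?_) rfl rfl
    by_cases hx : x ∈ X <;> simp [hx]
  · intro τ _ hτ
    by_cases h : ∀ x, x ∉ X → τ x = ρ x
    · have h4 : ¬ ∀ x, x ∉ Y → σ x = τ x := fun h5 => hτ <| by
        ext x
        by_cases hx : x ∈ X
        · simp [hx, h5 x (Finset.disjoint_left.1 hXY hx)]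
        · simp [hx, h x hx]
      rw [hN σ τ ρ, if_neg h4, zero_mul]
    · rw [hM τ ρ ρ, if_neg h, mul_zero]
  · simp
  · intro τ _ hτ
    by_cases h : ∀ x, x ∉ X → σ x = τ x
    · have h4 : ¬ ∀ x, x ∉ Y → τ x = ρ x := fun h5 => hτ <| by
        ext x
        by_cases hx : x ∈ X
        · simp [hx, h5 x (Finset.disjoint_left.1 hXY hx)]
        · simp [hx, h x hx]
      rw [hN τ ρ ρ, if_neg h4, mul_zero]
    · rw [hM σ τ ρ, if_neg h, zero_mul]
  · simp

theorem commute_of_mem_localObs {X Y : Finset Λ} (hXY : Disjoint X Y) {A B : Obs Λ q}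
    (hA : A ∈ localObs X) (hB : B ∈ localObs Y) : Commute A B := by
  obtain ⟨a, rfl⟩ := hA
  obtain ⟨b, rfl⟩ := hB
  simp only [Commute, SemiconjBy]
  rw [← map_mul, ← map_mul, (isLocalMatrix_tensorOne X a).mul_comm_of_disjoint hXY
    (isLocalMatrix_tensorOne Y b)]

variable [NeZero q]

theorem IsLocalMatrix.mem_localObs {X : Finset Λ} {M : Matrix (Λ → Fin q) (Λ → Fin q) ℂ}
    (hM : IsLocalMatrix X M) :
    (Matrix.toEuclideanCLM (n := Λ → Fin q) (𝕜 := ℂ) M : Obs Λ q) ∈ localObs X := by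
  obtain ⟨a, ha⟩ := hM.exists_eq
  exact ⟨a, by rw [← ha]⟩

/-- The product of a shift and a phase on the sites outside of `Y`. -/
def weylMatrix (Y : Finset Λ) (p : (Λ → Fin q) × AddChar (Λ → Fin q) ℂ) :
    Matrix (Λ → Fin q) (Λ → Fin q) ℂ :=
  Matrix.of fun σ τ => if σ = τ + offPart Y p.1 then p.2 (offPart Y σ) else 0

theorem isLocalMatrix_weylMatrix (Y : Finset Λ) (p : (Λ → Fin q) × AddChar (Λ → Fin q) ℂ) :
    IsLocalMatrix Yᶜ (weylMatrix Y p) := by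
  intro σ τ ρ
  simp only [weylMatrix, Matrix.of_apply]
  by_cases h : ∀ x, x ∉ Yᶜ → σ x = τ x
  · rw [if_pos h]
    refine if_congr ⟨fun h1 => ?_, fun h1 => ?_⟩ ?_ rfl
    · funext x
      have := congrFun h1 x
      by_cases hx : x ∈ Y
      · simp [hx, offPart_of_mem]
      · simpa [hx] using this
    · funext x
      have := congrFun h1 x
      by_cases hx : x ∈ Y
      · simp [hx, h x (by simpa using hx), offPart_of_mem]
      · simpa [hx] using this
    · exact congrArg p.2 (offPart_eq_iff.2 fun x hx => by simp [hx])
  · rw [if_neg h, if_neg]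
    rintro rfl
    refine h fun x hx => ?_
    have : x ∈ Y := by simpa using hx
    simp [this, offPart_of_mem]

theorem weylMatrix_conj_apply (Y : Finset Λ) (p : (Λ → Fin q) × AddChar (Λ → Fin q) ℂ)
    (M : Matrix (Λ → Fin q) (Λ → Fin q) ℂ) (σ τ : Λ → Fin q) :
    (weylMatrix Y p * M * (weylMatrix Y p).conjTranspose) σ τ =
      p.2 (offPart Y σ - offPart Y τ) *
        M (σ - offPart Y p.1) (τ - offPart Y p.1) := by
  have h1 : ∀ (N : Matrix (Λ → Fin q) (Λ → Fin q) ℂ) σ τ, (weylMatrix Y p * N) σ τ =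
      p.2 (offPart Y σ) * N (σ - offPart Y p.1) τ := fun N σ τ => by
    rw [Matrix.mul_apply, Finset.sum_eq_single (σ - offPart Y p.1)]
    · simp [weylMatrix]
    · intro ρ _ hρ
      rw [weylMatrix, Matrix.of_apply, if_neg, zero_mul]
      rintro rfl
      simp at hρ
    · simp
  have h2 : ∀ σ τ, (M * (weylMatrix Y p).conjTranspose) σ τ =
      M σ (τ - offPart Y p.1) * star (p.2 (offPart Y τ)) := fun σ τ => by
    rw [← Matrix.conjTranspose_conjTranspose M, ← Matrix.conjTranspose_mul,
      Matrix.conjTranspose_apply, h1]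
    simp [mul_comm]
  rw [mul_assoc, h1, h2, AddChar.map_sub_eq_div, div_eq_mul_inv]
  have h3 : star (p.2 (offPart Y τ)) = (p.2 (offPart Y τ))⁻¹ := by
    rw [← AddChar.map_neg_eq_inv, AddChar.map_neg_eq_conj]
    rfl
  rw [h3]
  ring

theorem weylMatrix_mem_unitary (Y : Finset Λ) (p : (Λ → Fin q) × AddChar (Λ → Fin q) ℂ) :
    weylMatrix Y p ∈ Matrix.unitaryGroup (Λ → Fin q) ℂ := by
  rw [Matrix.mem_unitaryGroup_iff]
  ext σ τ
  have h := weylMatrix_conj_apply Y p 1 σ τ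
  rw [mul_one] at h
  rw [Matrix.star_eq_conjTranspose, h, Matrix.one_apply, Matrix.one_apply]
  by_cases hst : σ = τ
  · simp [hst]
  · simp [hst]

/-- Shifts and phases on the sites outside of `Y`, as observables. -/
def weyl (Y : Finset Λ) (p : (Λ → Fin q) × AddChar (Λ → Fin q) ℂ) : Obs Λ q :=
  Matrix.toEuclideanCLM (n := Λ → Fin q) (𝕜 := ℂ) (weylMatrix Y p)

theorem weyl_mem_localObs (Y : Finset Λ) (p : (Λ → Fin q) × AddChar (Λ → Fin q) ℂ) :
    weyl Y p ∈ localObs Yᶜ :=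
  (isLocalMatrix_weylMatrix Y p).mem_localObs

theorem weyl_mem_unitary (Y : Finset Λ) (p : (Λ → Fin q) × AddChar (Λ → Fin q) ℂ) :
    weyl Y p ∈ unitary (Obs Λ q) :=
  Unitary.map_mem (Matrix.toEuclideanCLM (n := Λ → Fin q) (𝕜 := ℂ)) (weylMatrix_mem_unitary Y p)

/-- The normalized partial trace over the sites outside of `Y`. -/
def condExp (Y : Finset Λ) (A : Obs Λ q) : Obs Λ q :=
  unitaryAverage (weyl Y) A

/-- Orthogonality of characters removes the entries whose indices differ off `Y`; the shifts average
the others over the configurations off `Y`. -/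
theorem sum_weylMatrix_conj_apply (Y : Finset Λ) (M : Matrix (Λ → Fin q) (Λ → Fin q) ℂ)
    (σ τ : Λ → Fin q) :
    (∑ p, weylMatrix Y p * M * (weylMatrix Y p).conjTranspose :
      Matrix (Λ → Fin q) (Λ → Fin q) ℂ) σ τ =
      if ∀ x, x ∉ Y → σ x = τ x then (Fintype.card (Λ → Fin q) : ℂ) *
        ∑ g, M (σ - offPart Y g) (τ - offPart Y g) else 0 := by
  simp only [Matrix.sum_apply, weylMatrix_conj_apply]
  rw [Fintype.sum_prod_type]
  simp only
  simp only [← Finset.sum_mul, AddChar.sum_apply_eq_ite, sub_eq_zero]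
  rw [← Finset.mul_sum, ite_mul, zero_mul]
  exact if_congr offPart_eq_iff rfl rfl

theorem isLocalMatrix_sum_weylMatrix_conj (Y : Finset Λ)
    (M : Matrix (Λ → Fin q) (Λ → Fin q) ℂ) :
    IsLocalMatrix Y (∑ p, weylMatrix Y p * M * (weylMatrix Y p).conjTranspose) := by
  intro σ τ ρ
  rw [sum_weylMatrix_conj_apply]
  by_cases h : ∀ x, x ∉ Y → σ x = τ x
  · rw [if_pos h, if_pos h, sum_weylMatrix_conj_apply, if_pos fun x hx => by simp [hx]]
    congr 1
    -- Translating the shift by `ρ - σ` exchanges the common outer configuration `σ` for `ρ`.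
    refine Fintype.sum_equiv (Equiv.addRight (ρ - σ)) _ _ fun g => ?_
    congr 1 <;> funext x <;> by_cases hx : x ∈ Y
    · simp [hx, offPart_of_mem]
    · simp [hx, offPart_of_notMem]
      abel
    · simp [hx, offPart_of_mem]
    · simp [hx, offPart_of_notMem, h x]
      abel
  · rw [if_neg h, if_neg h]

theorem condExp_mem_localObs (Y : Finset Λ) (A : Obs Λ q) : condExp Y A ∈ localObs Y := by
  let e := Matrix.toEuclideanCLM (n := Λ → Fin q) (𝕜 := ℂ)
  have h1 : condExp Y A = e ((Fintype.card ((Λ → Fin q) × AddChar (Λ → Fin q) ℂ) : ℂ)⁻¹ •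
      ∑ p, weylMatrix Y p * e.symm A * (weylMatrix Y p).conjTranspose) := by
    rw [map_smul, map_sum]
    simp only [map_mul, StarAlgEquiv.apply_symm_apply, ← Matrix.star_eq_conjTranspose, map_star]
    rfl
  rw [h1]
  refine IsLocalMatrix.mem_localObs fun σ τ ρ => ?_
  rw [Matrix.smul_apply, Matrix.smul_apply, isLocalMatrix_sum_weylMatrix_conj Y _ σ τ ρ, smul_ite,
    smul_zero]

theorem condExp_eq_self {Y : Finset Λ} {A : Obs Λ q} (hA : A ∈ localObs Y) : condExp Y A = A :=
  unitaryAverage_of_commute (weyl_mem_unitary Y) fun p =>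
    commute_of_mem_localObs disjoint_compl_right hA (weyl_mem_localObs Y p)

end Locality

/-! ### Distances, thickenings and volume growth -/

section Geometry

variable {Λ : Type*} {G : SimpleGraph Λ}

theorem edist_le_graphDiam {Z : Finset Λ} {x y : Λ} (hx : x ∈ Z) (hy : y ∈ Z) :
    G.edist x y ≤ graphDiam G Z :=
  (Finset.le_sup (f := fun y => G.edist x y) hy).trans
    (Finset.le_sup (f := fun x => Z.sup fun y => G.edist x y) hx)

variable (G) in
/-- The distance from `X`, truncated at `k`. -/
def truncDist (X : Finset Λ) (k : ℕ) (x : Λ) : ℕ :=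
  (min (X.inf fun z => G.edist x z) (k : ℕ∞)).toNat

theorem coe_truncDist (X : Finset Λ) (k : ℕ) (x : Λ) :
    (truncDist G X k x : ℕ∞) = min (X.inf fun z => G.edist x z) (k : ℕ∞) :=
  ENat.natCast_toNat (ne_top_of_le_ne_top (ENat.natCast_ne_top k) (min_le_right _ _))

theorem truncDist_of_mem {X : Finset Λ} (k : ℕ) {x : Λ} (hx : x ∈ X) : truncDist G X k x = 0 := by
  have h : (truncDist G X k x : ℕ∞) ≤ 0 := by
    rw [coe_truncDist]
    exact (min_le_left _ _).trans ((Finset.inf_le hx).trans (by simp))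
  exact_mod_cast nonpos_iff_eq_zero.1 h

theorem truncDist_le_add (X : Finset Λ) (k : ℕ) {x y : Λ} {n : ℕ} (h : G.edist x y ≤ n) :
    truncDist G X k y ≤ truncDist G X k x + n := by
  have h1 : (truncDist G X k y : ℕ∞) ≤ truncDist G X k x + n := by
    rw [coe_truncDist, coe_truncDist, min_add]
    refine le_min ?_ ((min_le_right _ _).trans le_self_add)
    rcases X.eq_empty_or_nonempty with rfl | hX
    · simp
    · obtain ⟨z, hz, hz'⟩ := X.exists_mem_eq_inf hX fun z => G.edist x z
      rw [hz']
      refine (min_le_left _ _).trans ((Finset.inf_le hz).trans ?_)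
      rw [add_comm]
      exact (G.edist_triangle (v := x)).trans (by gcongr; rwa [G.edist_comm])
  exact_mod_cast h1

variable (G) in
/-- A weight that decays exponentially towards `X`. -/
def decayWeight (b : ℝ) (X : Finset Λ) (k : ℕ) (x : Λ) : ℝ :=
  Real.exp (b * (truncDist G X k x - k))

/-- The truncated distance is 1-Lipschitz, so the weight varies within `Z` by a factor of at most
`exp (b * diam Z)`. -/
theorem sum_decayWeight_le {b : ℝ} (hb : 0 ≤ b) (X : Finset Λ) (k : ℕ) {Z : Finset Λ}
    (hZ : graphDiam G Z ≠ ⊤) {x : Λ} (hx : x ∈ Z) :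
    ∑ y ∈ Z, decayWeight G b X k y ≤
      Z.card * Real.exp (b * (graphDiam G Z).toNat) * decayWeight G b X k x := by
  refine (Finset.sum_le_card_nsmul _ _
    (Real.exp (b * (graphDiam G Z).toNat) * decayWeight G b X k x) fun y hy => ?_).trans_eq ?_
  · rw [decayWeight, decayWeight, ← Real.exp_add]
    refine Real.exp_le_exp.2 ?_
    have h1 := truncDist_le_add X k (n := (graphDiam G Z).toNat) (x := x) (y := y)
      (by rw [ENat.natCast_toNat hZ]; exact edist_le_graphDiam hx hy)
    have h2 : (truncDist G X k y : ℝ) ≤ truncDist G X k x + (graphDiam G Z).toNat := by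
      exact_mod_cast h1
    nlinarith
  · simp [mul_assoc]

theorem sum_decayWeight_self (b : ℝ) (X : Finset Λ) (k : ℕ) :
    ∑ x ∈ X, decayWeight G b X k x = X.card * Real.exp (-(b * k)) := by
  rw [Finset.sum_congr rfl fun x hx => by rw [decayWeight, truncDist_of_mem k hx]]
  simp

theorem pow_le_mul_exp (D : ℕ) {a x : ℝ} (ha : 0 < a) (hx : 0 ≤ x) :
    x ^ D ≤ D.factorial / a ^ D * Real.exp (a * x) := by
  have h := Real.pow_div_factorial_le_exp (a * x) (by positivity) D
  have h2 : (0 : ℝ) < D.factorial := by positivity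
  rw [div_le_iff₀ h2, mul_pow] at h
  rw [div_mul_eq_mul_div, le_div_iff₀ (by positivity)]
  linarith

/-- Half of the decay absorbs the polynomial, at the price `D! / r ^ D`; the other half leaves a
geometric series, at most `(1 + r) / r`. The bound `R` keeps the remaining constant independent of
`r`. -/
theorem sum_pow_mul_exp_le (D n : ℕ) {r R : ℝ} (hr : 0 < r) (hrR : r ≤ R) :
    ∑ k ∈ Finset.range n, ((k : ℝ) + 1) ^ D * Real.exp (-(2 * r * k)) ≤
      D.factorial * (Real.exp R * (1 + R)) * (r ^ (D + 1))⁻¹ := by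
  have h1 : ∀ k : ℕ, ((k : ℝ) + 1) ^ D * Real.exp (-(2 * r * k)) ≤
      D.factorial / r ^ D * Real.exp r * Real.exp (-r) ^ k := fun k => by
    have h := pow_le_mul_exp D hr (x := (k : ℝ) + 1) (by positivity)
    calc _ ≤ D.factorial / r ^ D * Real.exp (r * (k + 1)) * Real.exp (-(2 * r * k)) := by gcongr
      _ = _ := by
        rw [← Real.exp_nat_mul, mul_assoc, mul_assoc (_ / _), ← Real.exp_add, ← Real.exp_add]
        ring_nf
  have hlt : Real.exp (-r) < 1 := by simpa using hr
  have h2 : ∑ k ∈ Finset.range n, Real.exp (-r) ^ k ≤ (1 + r) / r := by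
    have h3 : ∑ k ∈ Finset.range n, Real.exp (-r) ^ k ≤ (1 - Real.exp (-r))⁻¹ := by
      rw [← tsum_geometric_of_lt_one (Real.exp_nonneg _) hlt]
      exact (summable_geometric_of_lt_one (Real.exp_nonneg _) hlt).sum_le_tsum _
        fun _ _ => by positivity
    refine h3.trans ?_
    have h4 : Real.exp (-r) ≤ (1 + r)⁻¹ := by
      rw [Real.exp_neg]
      exact inv_anti₀ (by positivity) (by linarith [Real.add_one_le_exp r])
    rw [← inv_div]
    refine inv_anti₀ (by positivity) ?_
    have h5 : r / (1 + r) = 1 - (1 + r)⁻¹ := by field_simp; ring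
    linarith
  calc _ ≤ ∑ k ∈ Finset.range n, D.factorial / r ^ D * Real.exp r * Real.exp (-r) ^ k :=
        Finset.sum_le_sum fun k _ => h1 k
    _ ≤ D.factorial / r ^ D * Real.exp r * ((1 + r) / r) := by
        rw [← Finset.mul_sum]
        gcongr
    _ = D.factorial * (Real.exp r * (1 + r)) * (r ^ (D + 1))⁻¹ := by
        rw [pow_succ]; field_simp
    _ ≤ _ := by gcongr

variable [Fintype Λ]

variable (G) in
open Classical in
/-- The set of vertices at distance at most `k` from `Z`. -/
def thickening (Z : Finset Λ) (k : ℕ) : Finset Λ :=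
  Finset.univ.filter fun x => ∃ z ∈ Z, G.edist x z ≤ k

theorem mem_thickening {Z : Finset Λ} {k : ℕ} {x : Λ} :
    x ∈ thickening G Z k ↔ ∃ z ∈ Z, G.edist x z ≤ k := by
  simp [thickening]

theorem thickening_mono (Z : Finset Λ) {k l : ℕ} (h : k ≤ l) :
    thickening G Z k ⊆ thickening G Z l := fun x hx => by
  obtain ⟨z, hz, hxz⟩ := mem_thickening.1 hx
  exact mem_thickening.2 ⟨z, hz, hxz.trans (by exact_mod_cast h)⟩

theorem subset_thickening (Z : Finset Λ) (k : ℕ) : Z ⊆ thickening G Z k := fun x hx =>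
  mem_thickening.2 ⟨x, hx, by simp⟩

theorem graphDiam_thickening_le (Z : Finset Λ) (k : ℕ) :
    graphDiam G (thickening G Z k) ≤ graphDiam G Z + 2 * k := by
  refine Finset.sup_le fun x hx => Finset.sup_le fun y hy => ?_
  obtain ⟨x', hx', hxx'⟩ := mem_thickening.1 hx
  obtain ⟨y', hy', hyy'⟩ := mem_thickening.1 hy
  calc G.edist x y ≤ G.edist x x' + G.edist x' y := G.edist_triangle
    _ ≤ G.edist x x' + (G.edist x' y' + G.edist y' y) := by gcongr; exact G.edist_triangle
    _ ≤ k + (graphDiam G Z + k) := by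
        gcongr
        · exact edist_le_graphDiam hx' hy'
        · rwa [G.edist_comm]
    _ = graphDiam G Z + 2 * k := by ring

variable (G) in
/-- The largest finite distance between two vertices. -/
def maxDist : ℕ :=
  Finset.univ.sup fun p : Λ × Λ => (G.edist p.1 p.2).toNat

/-- From this radius on, the thickening is the union of the connected components that meet `Z`;
infinite distances count as `0` in `maxDist`. -/
theorem thickening_eq_of_maxDist_le (Z : Finset Λ) {k : ℕ} (hk : maxDist G ≤ k) :
    thickening G Z k = thickening G Z (maxDist G) := by
  refine subset_antisymm (fun x hx => ?_) (thickening_mono Z hk)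
  obtain ⟨z, hz, hxz⟩ := mem_thickening.1 hx
  refine mem_thickening.2 ⟨z, hz, ?_⟩
  have h1 : G.edist x z ≠ ⊤ := ne_top_of_le_ne_top (ENat.natCast_ne_top k) hxz
  rw [← ENat.natCast_toNat h1]
  exact_mod_cast Finset.le_sup (f := fun p : Λ × Λ => (G.edist p.1 p.2).toNat)
    (Finset.mem_univ (x, z))

theorem truncDist_of_notMem_thickening {X : Finset Λ} {k : ℕ} {x : Λ}
    (hx : x ∉ thickening G X k) : truncDist G X k x = k := by
  have h : (truncDist G X k x : ℕ∞) = k := by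
    rw [coe_truncDist]
    refine min_eq_right (Finset.le_inf fun z hz => ?_)
    by_contra h1
    exact hx (mem_thickening.2 ⟨z, hz, (not_le.1 h1).le⟩)
  exact_mod_cast h

theorem one_le_decayWeight [DecidableEq Λ] (b : ℝ) {X : Finset Λ} {k : ℕ} {x : Λ}
    (hx : x ∈ (thickening G X k)ᶜ) : 1 ≤ decayWeight G b X k x := by
  rw [decayWeight, truncDist_of_notMem_thickening (by simpa using hx)]
  simp

/-- `Z` lies in a ball of radius `diam Z` about any of its points. Unlike `K`, the resulting
constant depends only on the graph class and `a`, so it may enter the final `C`. -/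
theorem card_le_of_inGraphClass {D : ℕ} {Cvol a : ℝ} (hG : InGraphClass G D Cvol)
    (hCvol : 0 < Cvol) (ha : 0 < a) {Z : Finset Λ} (hZ : graphDiam G Z ≠ ⊤) (hZ' : Z.Nonempty) :
    (Z.card : ℝ) ≤ Cvol * (D.factorial / a ^ D * Real.exp a) *
      Real.exp (a * (graphDiam G Z).toNat) := by
  obtain ⟨x, hx⟩ := hZ'
  have h1 : (Z.card : ℝ) ≤ Set.ncard {z : Λ | G.edist z x ≤ ((graphDiam G Z).toNat : ℕ∞)} := by
    rw [← Set.ncard_coe_finset]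
    refine Nat.cast_le.2 (Set.ncard_le_ncard (fun y hy => ?_) (Set.toFinite _))
    rw [Set.mem_ofPred_eq, ENat.natCast_toNat hZ]
    exact edist_le_graphDiam hy hx
  refine (h1.trans (hG x _)).trans ?_
  have h2 := pow_le_mul_exp D ha (x := (graphDiam G Z).toNat + 1) (by positivity)
  rw [mul_add, mul_one, Real.exp_add] at h2
  calc _ ≤ Cvol * (D.factorial / a ^ D * (Real.exp (a * (graphDiam G Z).toNat) * Real.exp a)) := by
        gcongr
    _ = _ := by ring

end Geometry

/-! ### Quasi-locality of the filtered evolution and its shells -/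

section QuasiLocality

variable {Λ : Type*} [Fintype Λ] [DecidableEq Λ] {q : ℕ}

/-- A time-independent interaction whose norm with decay rate `p` is at most `N`. -/
structure IsDecaying (G : SimpleGraph Λ) (p N : ℝ) (Φ : Finset Λ → Obs Λ q) : Prop where
  mem_localObs : ∀ Z, Φ Z ∈ localObs Z
  isSelfAdjoint : ∀ Z, IsSelfAdjoint (Φ Z)
  eq_zero : ∀ Z, Z.Nonempty → graphDiam G Z = ⊤ → Φ Z = 0
  sum_le : ∀ x, ∑ Z : Finset Λ with x ∈ Z, ‖Φ Z‖ * Real.exp (p * (graphDiam G Z).toNat) ≤ N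

theorem norm_le_one_of_mem_unitary {𝔄 : Type*} [CStarAlgebra 𝔄] {U : 𝔄} (hU : U ∈ unitary 𝔄) :
    ‖U‖ ≤ 1 := by
  nontriviality 𝔄
  exact (CStarRing.norm_of_mem_unitary hU).le

variable {G : SimpleGraph Λ} {b b' K N : ℝ} {Φ : Finset Λ → Obs Λ q}

/-- The gap between `b` and `b'` pays for the volume: `|Z| exp (b * diam Z) ≤ K exp (b' * diam Z)`.
Hence `lieb_robinson` applies with `κ = K * N`. -/
theorem IsDecaying.sum_decayWeight_le (hΦ : IsDecaying G b' N Φ) (hK : IsVolumeConst G (b' - b) K)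
    (hb : 0 ≤ b) (X : Finset Λ) (k : ℕ) (x : Λ) :
    ∑ Z : Finset Λ with x ∈ Z, ‖Φ Z‖ * ∑ y ∈ Z, decayWeight G b X k y ≤
      K * N * decayWeight G b X k x := by
  have hw : 0 ≤ decayWeight G b X k x := (Real.exp_pos _).le
  have h1 : ∀ Z : Finset Λ, x ∈ Z → ‖Φ Z‖ * ∑ y ∈ Z, decayWeight G b X k y ≤
      K * decayWeight G b X k x * (‖Φ Z‖ * Real.exp (b' * (graphDiam G Z).toNat)) := fun Z hx => by
    by_cases hZ : graphDiam G Z = ⊤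
    · simp [hΦ.eq_zero Z ⟨x, hx⟩ hZ]
    · have h2 := hK.2 Z hZ
      have h3 : (Z.card : ℝ) * Real.exp (b * (graphDiam G Z).toNat) ≤
          K * Real.exp (b' * (graphDiam G Z).toNat) := by
        calc _ = (Z.card : ℝ) * Real.exp (-(b' - b) * (graphDiam G Z).toNat) *
              Real.exp (b' * (graphDiam G Z).toNat) := by
              rw [mul_assoc, ← Real.exp_add]; ring_nf
          _ ≤ _ := by gcongr
      calc _ ≤ ‖Φ Z‖ * (Z.card * Real.exp (b * (graphDiam G Z).toNat) *
            decayWeight G b X k x) := by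
            gcongr
            exact SpinLattice.sum_decayWeight_le hb X k hZ hx
        _ ≤ ‖Φ Z‖ * (K * Real.exp (b' * (graphDiam G Z).toNat) * decayWeight G b X k x) := by
            gcongr
        _ = _ := by ring
  have hK0 : 0 ≤ K := zero_le_one.trans hK.1
  calc _ ≤ ∑ Z : Finset Λ with x ∈ Z, K * decayWeight G b X k x *
        (‖Φ Z‖ * Real.exp (b' * (graphDiam G Z).toNat)) :=
        Finset.sum_le_sum fun Z hZ => h1 Z (Finset.mem_filter.1 hZ).2
    _ ≤ K * decayWeight G b X k x * N := by
        rw [← Finset.mul_sum]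
        gcongr
        exact hΦ.sum_le x
    _ = _ := by ring

theorem IsDecaying.isSelfAdjoint_sum (hΦ : IsDecaying G b' N Φ) : IsSelfAdjoint (∑ Z, Φ Z) :=
  _root_.isSelfAdjoint_sum (R := Obs Λ q) _ fun Z _ => hΦ.isSelfAdjoint Z

/-- The Lieb-Robinson bound for positive times. -/
theorem IsDecaying.norm_lie_evolution_le (hΦ : IsDecaying G b' N Φ)
    (hK : IsVolumeConst G (b' - b) K) (hb : 0 ≤ b) (hN : 0 ≤ N) {X : Finset Λ} {k : ℕ}
    {A B : Obs Λ q} (hA : A ∈ localObs X) (hB : B ∈ localObs (thickening G X k)ᶜ) (hB1 : ‖B‖ ≤ 1)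
    {s : ℝ} (hs : 0 ≤ s) :
    ‖⁅evolution (∑ Z, Φ Z) s A, B⁆‖ ≤
      2 * ‖A‖ * X.card * Real.exp (-(b * k) + 2 * (K * N) * s) := by
  have hK0 : 0 ≤ K := zero_le_one.trans hK.1
  refine (lieb_robinson hΦ.isSelfAdjoint
    (fun Z Z' h => commute_of_mem_localObs h (hΦ.mem_localObs Z) (hΦ.mem_localObs Z'))
    (w := decayWeight G b X k) (fun x => Real.exp_pos _) (κ := K * N) (by positivity)
    (hΦ.sum_decayWeight_le hK hb X k) (fun y hy => one_le_decayWeight b hy)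
    (fun Z h => commute_of_mem_localObs h (hΦ.mem_localObs Z) hB)
    (fun Z h => commute_of_mem_localObs h hA (hΦ.mem_localObs Z))
    (commute_of_mem_localObs (Finset.disjoint_left.2 fun x hx hx' =>
      (Finset.mem_compl.1 hx') (subset_thickening X k hx)) hA hB) hs).trans ?_
  rw [sum_decayWeight_self, Real.exp_add]
  calc _ ≤ 2 * ‖A‖ * 1 * (X.card * Real.exp (-(b * k))) * Real.exp (2 * (K * N) * s) := by
        have h1 : 1 ≤ Real.exp (2 * (K * N) * s) := Real.one_le_exp (by positivity)
        gcongr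
        linarith
    _ = _ := by ring

theorem neg_mem_localObs {X : Finset Λ} {A : Obs Λ q} (hA : A ∈ localObs X) :
    -A ∈ localObs X := by
  obtain ⟨a, rfl⟩ := hA
  refine ⟨-a, ?_⟩
  simp only
  rw [← map_neg]
  congr 1
  ext σ τ
  simp only [tensorOne, Matrix.of_apply, Matrix.neg_apply]
  split_ifs <;> simp

theorem IsDecaying.neg (hΦ : IsDecaying G b' N Φ) : IsDecaying G b' N fun Z => -Φ Z where
  mem_localObs Z := neg_mem_localObs (hΦ.mem_localObs Z)
  isSelfAdjoint Z := IsSelfAdjoint.neg (R := Obs Λ q) (hΦ.isSelfAdjoint Z)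
  eq_zero Z h1 h2 := by rw [hΦ.eq_zero Z h1 h2, neg_zero]
  sum_le x := by simpa only [norm_neg] using hΦ.sum_le x

theorem IsDecaying.norm_lie_evolution_le_abs (hΦ : IsDecaying G b' N Φ)
    (hK : IsVolumeConst G (b' - b) K) (hb : 0 ≤ b) (hN : 0 ≤ N) {X : Finset Λ} {k : ℕ}
    {A B : Obs Λ q} (hA : A ∈ localObs X) (hB : B ∈ localObs (thickening G X k)ᶜ) (hB1 : ‖B‖ ≤ 1)
    (s : ℝ) :
    ‖⁅evolution (∑ Z, Φ Z) s A, B⁆‖ ≤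
      2 * ‖A‖ * X.card * Real.exp (-(b * k) + 2 * (K * N) * |s|) := by
  rcases le_total 0 s with hs | hs
  · rw [abs_of_nonneg hs]
    exact hΦ.norm_lie_evolution_le hK hb hN hA hB hB1 hs
  · rw [abs_of_nonpos hs]
    have h := hΦ.neg.norm_lie_evolution_le hK hb hN hA hB hB1 (neg_nonneg.2 hs)
    rwa [Finset.sum_neg_distrib, evolution_neg_left, neg_neg] at h

theorem gaussian_const_le {β : ℝ} (hβ : 0 < β) {C : ℝ} (hC : 0 ≤ C) :
    C * (β / √Real.pi) * (β ^ 2 - 5 / 6 * β ^ 2)⁻¹ ≤ 6 * C / β := by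
  have h1 : 1 ≤ √Real.pi := Real.one_le_sqrt.2 (by linarith [Real.pi_gt_three])
  have h2 : β / √Real.pi ≤ β := div_le_self hβ.le h1
  have h3 : β ^ 2 - 5 / 6 * β ^ 2 = β ^ 2 / 6 := by ring
  rw [h3]
  calc _ ≤ C * β * (β ^ 2 / 6)⁻¹ := by gcongr
    _ = _ := by field_simp

variable {v r β : ℝ}

/-- The fraction `5/6` is below `1`, so that the Gaussian filter wins, and above `2/3`, so that the
decay outlasts the growth of the weight `exp (r/3 · diam)` on thickenings. -/
theorem IsDecaying.norm_lie_filteredEvolution_le (hΦ : IsDecaying G b' N Φ)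
    (hK : IsVolumeConst G (b' - b) K) (hb : 0 ≤ b) (hN : 0 ≤ N) (hβ : 0 < β)
    (hr : 0 ≤ r) (hrb : r ≤ b / 2) (hrv : 4 * v ^ 2 * r ≤ β ^ 2) (hv : b * v = 2 * (K * N))
    {X : Finset Λ} {k : ℕ} {A B : Obs Λ q} (hA : A ∈ localObs X)
    (hB : B ∈ localObs (thickening G X k)ᶜ) (hB1 : ‖B‖ ≤ 1) :
    ‖⁅filteredEvolution (∑ Z, Φ Z) β A, B⁆‖ ≤
      12 * ‖A‖ * (X.card + 1) * Real.exp (-(5 / 6 * (r * k))) / β := by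
  have hβ2 : 0 < β ^ 2 := by positivity
  -- Integrality of `k` gives `r k ≤ r k² ≤ 4 v² r u² ≤ β² u²` when `k < 2 v u`.
  have hk : (k : ℝ) ≤ (k : ℝ) ^ 2 := by exact_mod_cast Nat.le_self_pow two_ne_zero k
  refine (SpinLattice.norm_lie_filteredEvolution_le hΦ.isSelfAdjoint_sum hβ (c := 5 / 6 * β ^ 2)
    (C := 2 * ‖A‖ * (X.card + 1) * Real.exp (-(5 / 6 * (r * k)))) (by positivity)
    (by linarith) (by positivity) fun s => ?_).trans
    ((gaussian_const_le hβ (by positivity)).trans_eq (by ring))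
  rw [← sq_abs s]
  refine le_gaussian_of_lieb_robinson (σ := v) (B := b) (by positivity) (by positivity) hb hr
    (by positivity) (fun u hu hku => ?_) ?_ (abs_nonneg s) ?_ ?_
  · calc r * k ≤ r * k ^ 2 := by gcongr
      _ ≤ r * (2 * v * u) ^ 2 := by gcongr
      _ = 4 * v ^ 2 * r * u ^ 2 := by ring
      _ ≤ β ^ 2 * u ^ 2 := by gcongr
  · have := mul_le_mul_of_nonneg_right hrb (Nat.cast_nonneg (α := ℝ) k)
    linarith
  · refine (norm_lie_le _ _).trans ?_
    rw [norm_evolution hΦ.isSelfAdjoint_sum]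
    exact mul_le_of_le_one_right (by positivity) hB1
  · rw [hv]
    exact hΦ.norm_lie_evolution_le_abs hK hb hN hA hB hB1 s

variable [NeZero q]

/-- Local observables become the fixed points of a bounded linear map, hence are stable under sums,
differences and derivatives. -/
theorem mem_localObs_iff {Y : Finset Λ} {A : Obs Λ q} : A ∈ localObs Y ↔ condExp Y A = A :=
  ⟨condExp_eq_self, fun h => h ▸ condExp_mem_localObs Y A⟩

theorem localObs_mono {X Y : Finset Λ} (h : X ⊆ Y) {A : Obs Λ q} (hA : A ∈ localObs X) :
    A ∈ localObs Y :=
  mem_localObs_iff.2 <| unitaryAverage_of_commute (weyl_mem_unitary Y) fun p =>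
    commute_of_mem_localObs (Finset.disjoint_left.2 fun _ hx hx' =>
      (Finset.mem_compl.1 hx') (h hx)) hA (weyl_mem_localObs Y p)

/-- `condExp` as a bounded operator. -/
def condExpCLM (Y : Finset Λ) : Obs Λ q →L[ℝ] Obs Λ q :=
  unitaryAverageCLM (weyl Y)

theorem condExpCLM_apply (Y : Finset Λ) (A : Obs Λ q) : condExpCLM Y A = condExp Y A := rfl

theorem sub_mem_localObs {X : Finset Λ} {A B : Obs Λ q} (hA : A ∈ localObs X)
    (hB : B ∈ localObs X) : A - B ∈ localObs X := by
  rw [mem_localObs_iff] at *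
  rw [← condExpCLM_apply, map_sub, condExpCLM_apply, condExpCLM_apply, hA, hB]

theorem sum_mem_localObs {ι : Type*} {S : Finset ι} {X : Finset Λ} {A : ι → Obs Λ q}
    (hA : ∀ i ∈ S, A i ∈ localObs X) : ∑ i ∈ S, A i ∈ localObs X := by
  rw [mem_localObs_iff, ← condExpCLM_apply, map_sum]
  exact Finset.sum_congr rfl fun i hi => mem_localObs_iff.1 (hA i hi)

theorem isSelfAdjoint_condExp (Y : Finset Λ) {A : Obs Λ q} (hA : IsSelfAdjoint A) :
    IsSelfAdjoint (condExp Y A) := by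
  have h := star_unitaryAverage (weyl Y) A
  rw [hA.star_eq] at h
  exact h

theorem IsDecaying.norm_sub_condExp_le (hΦ : IsDecaying G b' N Φ)
    (hK : IsVolumeConst G (b' - b) K) (hb : 0 ≤ b) (hN : 0 ≤ N) (hβ : 0 < β)
    (hr : 0 ≤ r) (hrb : r ≤ b / 2) (hrv : 4 * v ^ 2 * r ≤ β ^ 2) (hv : b * v = 2 * (K * N))
    {X : Finset Λ} (k : ℕ) {A : Obs Λ q} (hA : A ∈ localObs X) :
    ‖filteredEvolution (∑ Z, Φ Z) β A -
        condExp (thickening G X k) (filteredEvolution (∑ Z, Φ Z) β A)‖ ≤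
      12 * ‖A‖ * (X.card + 1) * Real.exp (-(5 / 6 * (r * k))) / β :=
  norm_sub_unitaryAverage_le (weyl_mem_unitary _) fun p =>
    hΦ.norm_lie_filteredEvolution_le hK hb hN hβ hr hrb hrv hv hA (weyl_mem_localObs _ p)
      (norm_le_one_of_mem_unitary (weyl_mem_unitary _ p))

/-- Beyond `maxDist G` the thickening no longer changes while the error bound tends to zero, so the
error vanishes. Finitely many shells therefore recover the whole operator. -/
theorem IsDecaying.condExp_maxDist (hΦ : IsDecaying G b' N Φ)
    (hK : IsVolumeConst G (b' - b) K) (hb : 0 ≤ b) (hN : 0 ≤ N) (hβ : 0 < β)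
    (hr : 0 < r) (hrb : r ≤ b / 2) (hrv : 4 * v ^ 2 * r ≤ β ^ 2) (hv : b * v = 2 * (K * N))
    {X : Finset Λ} {A : Obs Λ q} (hA : A ∈ localObs X) :
    condExp (thickening G X (maxDist G)) (filteredEvolution (∑ Z, Φ Z) β A) =
      filteredEvolution (∑ Z, Φ Z) β A := by
  refine (sub_eq_zero.1 (norm_le_zero_iff.1 ?_)).symm
  have hlim : Filter.Tendsto (fun k : ℕ => 12 * ‖A‖ * (X.card + 1) *
      Real.exp (-(5 / 6 * (r * k))) / β) Filter.atTop (nhds (12 * ‖A‖ * (X.card + 1) * 0 / β)) := by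
    refine (Filter.Tendsto.const_mul _ (Real.tendsto_exp_neg_atTop_nhds_zero.comp ?_)).div_const _
    exact ((tendsto_natCast_atTop_atTop.const_mul_atTop hr).const_mul_atTop (by norm_num))
  rw [mul_zero, zero_div] at hlim
  refine ge_of_tendsto hlim ((Filter.eventually_ge_atTop (maxDist G)).mono fun k hk => ?_)
  rw [← thickening_eq_of_maxDist_le X hk]
  exact hΦ.norm_sub_condExp_le hK hb hN hβ hr.le hrb hrv hv k hA

variable (G) in
/-- The contribution to `J` from the sites at distance `k` of `X`. -/
def shell (X : Finset Λ) (J : Obs Λ q) : ℕ → Obs Λ q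
  | 0 => condExp (thickening G X 0) J
  | k + 1 => condExp (thickening G X (k + 1)) J - condExp (thickening G X k) J

theorem sum_shell (X : Finset Λ) (J : Obs Λ q) (n : ℕ) :
    ∑ k ∈ Finset.range (n + 1), shell G X J k = condExp (thickening G X n) J := by
  induction n with
  | zero => simp [shell]
  | succ n ih => rw [Finset.sum_range_succ, ih, shell, add_sub_cancel]

theorem shell_mem_localObs (X : Finset Λ) (J : Obs Λ q) (k : ℕ) :
    shell G X J k ∈ localObs (thickening G X k) := by
  cases k with
  | zero => exact condExp_mem_localObs _ J
  | succ k =>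
    exact sub_mem_localObs (condExp_mem_localObs _ J)
      (localObs_mono (thickening_mono X k.le_succ) (condExp_mem_localObs _ J))

theorem isSelfAdjoint_shell (X : Finset Λ) {J : Obs Λ q} (hJ : IsSelfAdjoint J) (k : ℕ) :
    IsSelfAdjoint (shell G X J k) := by
  cases k with
  | zero => exact isSelfAdjoint_condExp _ hJ
  | succ k =>
    exact IsSelfAdjoint.sub (R := Obs Λ q) (isSelfAdjoint_condExp _ hJ) (isSelfAdjoint_condExp _ hJ)

theorem IsDecaying.norm_shell_le (hΦ : IsDecaying G b' N Φ)
    (hK : IsVolumeConst G (b' - b) K) (hb : 0 ≤ b) (hN : 0 ≤ N) (hβ : 0 < β)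
    (hr : 0 ≤ r) (hrb : r ≤ b / 2) (hrv : 4 * v ^ 2 * r ≤ β ^ 2) (hv : b * v = 2 * (K * N))
    {X : Finset Λ} (k : ℕ) {A : Obs Λ q} (hA : A ∈ localObs X) :
    ‖shell G X (filteredEvolution (∑ Z, Φ Z) β A) k‖ ≤
      24 * Real.exp b * ‖A‖ * (X.card + 1) * Real.exp (-(5 / 6 * (r * k))) / β := by
  have hexp : 1 ≤ Real.exp b := Real.one_le_exp hb
  cases k with
  | zero =>
    rw [shell]
    refine (norm_unitaryAverage_le (weyl_mem_unitary _) _).trans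
      ((norm_filteredEvolution_le hΦ.isSelfAdjoint_sum hβ A).trans ?_)
    have h1 : ‖A‖ * (β / √Real.pi) * (β ^ 2 - 0)⁻¹ ≤
        ‖A‖ * (β / √Real.pi) * (β ^ 2 - 5 / 6 * β ^ 2)⁻¹ := by
      have h2 : 0 < β ^ 2 := by positivity
      gcongr <;> linarith
    refine h1.trans ((gaussian_const_le hβ (norm_nonneg A)).trans ?_)
    rw [Nat.cast_zero, mul_zero, mul_zero, neg_zero, Real.exp_zero, mul_one]
    refine div_le_div_of_nonneg_right ?_ hβ.le
    calc 6 * ‖A‖ ≤ 24 * 1 * ‖A‖ * (0 + 1) := by linarith [norm_nonneg A]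
      _ ≤ 24 * Real.exp b * ‖A‖ * (X.card + 1) := by gcongr; positivity
  | succ k =>
    set J := filteredEvolution (∑ Z, Φ Z) β A with hJ
    have h1 := hΦ.norm_sub_condExp_le hK hb hN hβ hr hrb hrv hv k hA
    have h2 := hΦ.norm_sub_condExp_le hK hb hN hβ hr hrb hrv hv (k + 1) hA
    rw [← hJ] at h1 h2
    have h3 : shell G X J (k + 1) = (J - condExp (thickening G X k) J) -
        (J - condExp (thickening G X (k + 1)) J) := by
      rw [shell]; abel
    -- The factor `exp b` pays for the step from `k` to `k + 1`, since `5/6 r ≤ b`.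
    have h4 : Real.exp (-(5 / 6 * (r * k))) ≤
        Real.exp b * Real.exp (-(5 / 6 * (r * (k + 1 : ℕ)))) := by
      rw [← Real.exp_add]
      refine Real.exp_le_exp.2 ?_
      push_cast
      linarith
    have h5 : Real.exp (-(5 / 6 * (r * (k + 1 : ℕ)))) ≤
        Real.exp b * Real.exp (-(5 / 6 * (r * (k + 1 : ℕ)))) :=
      le_mul_of_one_le_left (Real.exp_nonneg _) hexp
    rw [h3]
    calc _ ≤ 12 * ‖A‖ * (X.card + 1) * Real.exp (-(5 / 6 * (r * k))) / β +
          12 * ‖A‖ * (X.card + 1) * Real.exp (-(5 / 6 * (r * (k + 1 : ℕ)))) / β :=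
          (norm_sub_le _ _).trans (add_le_add h1 h2)
      _ ≤ 12 * ‖A‖ * (X.card + 1) *
            (Real.exp b * Real.exp (-(5 / 6 * (r * (k + 1 : ℕ))))) / β +
          12 * ‖A‖ * (X.card + 1) *
            (Real.exp b * Real.exp (-(5 / 6 * (r * (k + 1 : ℕ))))) / β := by gcongr
      _ = _ := by ring

end QuasiLocality

/-! ### Interaction norms and summation of the shells -/

section Interactions

variable {Λ : Type*} [Fintype Λ] [DecidableEq Λ] {q : ℕ} {G : SimpleGraph Λ}

theorem enorm_zero_obs : ‖(0 : Obs Λ q)‖ₑ = 0 := by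
  rw [← ofReal_norm, norm_zero, ENNReal.ofReal_zero]

theorem enorm_ne_zero_obs {A : Obs Λ q} (hA : A ≠ 0) : ‖A‖ₑ ≠ 0 := by
  rw [← ofReal_norm, ne_eq, ENNReal.ofReal_eq_zero, not_le]
  exact norm_pos_iff.2 hA

theorem enorm_sum_le_obs {ι : Type*} (S : Finset ι) (A : ι → Obs Λ q) :
    ‖∑ i ∈ S, A i‖ₑ ≤ ∑ i ∈ S, ‖A i‖ₑ := by
  simp only [← ofReal_norm]
  rw [← ENNReal.ofReal_sum_of_nonneg fun i _ => norm_nonneg (A i)]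
  exact ENNReal.ofReal_le_ofReal (norm_sum_le _ _)

theorem sum_le_interactionNorm {I : Set ℝ} {p : ℝ} {Φ : ℝ → Finset Λ → Obs Λ q} {t : ℝ}
    (ht : t ∈ I) (x : Λ) :
    ∑ Z : Finset Λ with x ∈ Z, ‖Φ t Z‖ₑ * expWeight G p Z ≤ interactionNorm G I p Φ :=
  (le_iSup (fun z : Λ => ∑ Z : Finset Λ with z ∈ Z, ‖Φ t Z‖ₑ * expWeight G p Z) x).trans
    (le_iSup₂ (f := fun t (_ : t ∈ I) => ⨆ z : Λ, ∑ Z : Finset Λ with z ∈ Z,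
      ‖Φ t Z‖ₑ * expWeight G p Z) t ht)

theorem IsInteraction.isDecaying {I : Set ℝ} {p : ℝ} {Φ : ℝ → Finset Λ → Obs Λ q}
    (hΦ : IsInteraction I Φ) (hfin : interactionNorm G I p Φ < ⊤) {t : ℝ} (ht : t ∈ I) :
    IsDecaying G p (interactionNorm G I p Φ).toReal (Φ t) := by
  -- A nonzero term on a disconnected support would carry infinite weight and make the norm
  -- infinite.
  have hzero : ∀ Z : Finset Λ, Z.Nonempty → graphDiam G Z = ⊤ → Φ t Z = 0 := fun Z hZ hd => by
    obtain ⟨x, hx⟩ := hZ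
    by_contra h
    refine hfin.not_ge (le_trans ?_ (sum_le_interactionNorm ht x))
    refine le_trans ?_ (Finset.single_le_sum (f := fun Z => ‖Φ t Z‖ₑ * expWeight G p Z)
      (fun _ _ => zero_le) (by simpa using hx : Z ∈ Finset.univ.filter fun Z => x ∈ Z))
    rw [expWeight, if_pos hd, ENNReal.mul_top (enorm_ne_zero_obs h)]
  refine ⟨fun Z => (hΦ t ht Z).1, fun Z => (hΦ t ht Z).2, hzero, fun x => ?_⟩
  rw [← ENNReal.ofReal_le_iff_le_toReal hfin.ne, ENNReal.ofReal_sum_of_nonneg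
    fun Z _ => by positivity]
  refine le_trans (Finset.sum_le_sum fun Z hZ => ?_) (sum_le_interactionNorm ht x)
  by_cases hd : graphDiam G Z = ⊤
  · simp [hzero Z ⟨x, (Finset.mem_filter.1 hZ).2⟩ hd]
  · rw [expWeight, if_neg hd, ENNReal.ofReal_mul (norm_nonneg _), ofReal_norm]

theorem derivWithin_map {E F : Type*} [NormedAddCommGroup E] [NormedSpace ℝ E]
    [NormedAddCommGroup F] [NormedSpace ℝ F] {f : ℝ → E} {I : Set ℝ} {t : ℝ}
    (hI : UniqueDiffWithinAt ℝ I t) (hf : DifferentiableWithinAt ℝ f I t) (L : E →L[ℝ] F) :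
    derivWithin (fun s => L (f s)) I t = L (derivWithin f I t) :=
  (L.hasFDerivAt.comp_hasDerivWithinAt t hf.hasDerivWithinAt).derivWithin hI

/-- With `L` the partial trace or `star`, this carries locality and self-adjointness from `Φ` to its
time derivative. -/
theorem derivWithin_fixed {E : Type*} [NormedAddCommGroup E] [NormedSpace ℝ E] {f : ℝ → E}
    {I : Set ℝ} {t : ℝ} (hI : UniqueDiffWithinAt ℝ I t) (ht : t ∈ I)
    (hf : DifferentiableWithinAt ℝ f I t) (L : E →L[ℝ] E) (hL : ∀ s ∈ I, L (f s) = f s) :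
    L (derivWithin f I t) = derivWithin f I t := by
  rw [← derivWithin_map hI hf L]
  exact derivWithin_congr hL (hL t ht)

theorem isSelfAdjoint_derivWithin {𝔄 : Type*} [CStarAlgebra 𝔄] {f : ℝ → 𝔄} {I : Set ℝ} {t : ℝ}
    (hI : UniqueDiffWithinAt ℝ I t) (ht : t ∈ I) (hf : DifferentiableWithinAt ℝ f I t)
    (hsa : ∀ s ∈ I, IsSelfAdjoint (f s)) : IsSelfAdjoint (derivWithin f I t) :=
  derivWithin_fixed hI ht hf ((starL' ℝ : 𝔄 ≃L[ℝ] 𝔄) : 𝔄 →L[ℝ] 𝔄) fun s hs => (hsa s hs).star_eq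

theorem IsInteraction.timeDeriv [NeZero q] {I : Set ℝ} {Φ : ℝ → Finset Λ → Obs Λ q}
    (hΦ : IsInteraction I Φ) (hI : UniqueDiffOn ℝ I)
    (hd : ∀ Z, DifferentiableOn ℝ (fun t => Φ t Z) I) :
    IsInteraction I (timeDeriv I Φ) := fun t ht Z =>
  ⟨mem_localObs_iff.2 <| derivWithin_fixed (hI t ht) ht (hd Z t ht) (condExpCLM Z)
    fun s hs => mem_localObs_iff.1 (hΦ s hs Z).1,
    isSelfAdjoint_derivWithin (𝔄 := Obs Λ q) (hI t ht) ht (hd Z t ht) fun s hs => (hΦ s hs Z).2⟩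

theorem derivWithin_hamiltonian {I : Set ℝ} {Φ : ℝ → Finset Λ → Obs Λ q}
    (hd : ∀ Z, DifferentiableOn ℝ (fun t => Φ t Z) I) {t : ℝ} (ht : t ∈ I) :
    derivWithin (hamiltonian Φ) I t = ∑ Z, timeDeriv I Φ t Z :=
  derivWithin_fun_sum fun Z _ => hd Z t ht

variable [NeZero q] {b b' K N v r β c : ℝ} {Φ : Finset Λ → Obs Λ q}

/-- Balance of exponents, using that thickening adds at most `2 k` to the diameter: in `k`, `-5/6 r
+ 2/3 r = -2 (r / 12)`; in `diam Z`, the volume costs `b' - b` and the weight `r / 3 ≤ b`, together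
at most `b'`. -/
theorem IsDecaying.enorm_shell_mul_expWeight_le (hΦ : IsDecaying G b' N Φ)
    (hK : IsVolumeConst G (b' - b) K) (hb : 0 ≤ b) (hN : 0 ≤ N) (hβ : 0 < β)
    (hr : 0 ≤ r) (hrb : r ≤ b / 2) (hrv : 4 * v ^ 2 * r ≤ β ^ 2) (hv : b * v = 2 * (K * N))
    (hc : 0 < c) {Z : Finset Λ} (hZ : Z.Nonempty)
    (hcZ : graphDiam G Z ≠ ⊤ → (Z.card : ℝ) ≤ c * Real.exp ((b' - b) * (graphDiam G Z).toNat))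
    (k : ℕ) {A : Obs Λ q} (hA : A ∈ localObs Z) :
    ‖shell G Z (filteredEvolution (∑ Z, Φ Z) β A) k‖ₑ * expWeight G (r / 3) (thickening G Z k) ≤
      ENNReal.ofReal (48 * Real.exp b * c / β * Real.exp (-(2 * (r / 12) * k))) *
        (‖A‖ₑ * expWeight G b' Z) := by
  have h := hΦ.norm_shell_le hK hb hN hβ hr hrb hrv hv k hA
  -- For `A = 0` both sides vanish, even with an infinite weight; for `A ≠ 0` and infinite diameter
  -- the right-hand side is infinite.
  by_cases hA0 : A = 0
  · rw [hA0, norm_zero] at h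
    have h0 : ‖shell G Z (filteredEvolution (∑ Z, Φ Z) β 0) k‖ = 0 :=
      le_antisymm (by simpa using h) (norm_nonneg _)
    rw [hA0, norm_eq_zero.1 h0, enorm_zero_obs, zero_mul, zero_mul]
    exact zero_le
  by_cases hd : graphDiam G Z = ⊤
  · have h1 : ENNReal.ofReal (48 * Real.exp b * c / β * Real.exp (-(2 * (r / 12) * k))) ≠ 0 := by
      rw [ne_eq, ENNReal.ofReal_eq_zero, not_le]
      positivity
    rw [expWeight.eq_def G b' Z, if_pos hd, ENNReal.mul_top (enorm_ne_zero_obs hA0),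
      ENNReal.mul_top h1]
    exact le_top
  have hle := graphDiam_thickening_le (G := G) Z k
  have hd' : graphDiam G (thickening G Z k) ≠ ⊤ := by
    refine ne_top_of_le_ne_top ?_ hle
    rw [← ENat.natCast_toNat hd]
    exact_mod_cast ENat.natCast_ne_top ((graphDiam G Z).toNat + 2 * k)
  have hle' : ((graphDiam G (thickening G Z k)).toNat : ℝ) ≤ (graphDiam G Z).toNat + 2 * k := by
    rw [← ENat.natCast_toNat hd, ← ENat.natCast_toNat hd'] at hle
    exact_mod_cast hle
  rw [expWeight, expWeight, if_neg hd, if_neg hd', ← ofReal_norm, ← ofReal_norm,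
    ← ENNReal.ofReal_mul (norm_nonneg _), ← ENNReal.ofReal_mul (norm_nonneg _),
    ← ENNReal.ofReal_mul (by positivity)]
  refine ENNReal.ofReal_le_ofReal ?_
  set n : ℝ := ((graphDiam G Z).toNat : ℝ) with hn
  have hn0 : 0 ≤ n := Nat.cast_nonneg _
  have hcard : (Z.card : ℝ) + 1 ≤ 2 * (c * Real.exp ((b' - b) * n)) := by
    have h1 : (1 : ℝ) ≤ Z.card := by exact_mod_cast hZ.card_pos
    linarith [hcZ hd]
  calc _ ≤ 24 * Real.exp b * ‖A‖ * (Z.card + 1) * Real.exp (-(5 / 6 * (r * k))) / β *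
        Real.exp (r / 3 * (n + 2 * k)) := by gcongr
    _ ≤ 24 * Real.exp b * ‖A‖ * (2 * (c * Real.exp ((b' - b) * n))) *
        Real.exp (-(5 / 6 * (r * k))) / β * Real.exp (r / 3 * (n + 2 * k)) := by gcongr
    _ = 48 * Real.exp b * c / β * ‖A‖ * (Real.exp ((b' - b) * n) *
        Real.exp (-(5 / 6 * (r * k))) * Real.exp (r / 3 * (n + 2 * k))) := by ring
    _ ≤ 48 * Real.exp b * c / β * ‖A‖ *
        (Real.exp (-(2 * (r / 12) * k)) * Real.exp (b' * n)) := by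
        refine mul_le_mul_of_nonneg_left ?_ (by positivity)
        rw [← Real.exp_add, ← Real.exp_add, ← Real.exp_add]
        refine Real.exp_le_exp.2 ?_
        have h2 : r / 3 * n ≤ b * n := by gcongr; linarith
        linarith
    _ = _ := by ring

variable (G) in
/-- The interaction obtained by splitting the operators `J Z` into shells. -/
def shellInteraction (J : Finset Λ → Obs Λ q) (Y : Finset Λ) : Obs Λ q :=
  ∑ Z, ∑ k ∈ Finset.range (maxDist G + 1),
    if thickening G Z k = Y then shell G Z (J Z) k else 0

theorem sum_shellInteraction (J : Finset Λ → Obs Λ q) :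
    ∑ Y, shellInteraction G J Y = ∑ Z, condExp (thickening G Z (maxDist G)) (J Z) := by
  simp only [shellInteraction]
  rw [Finset.sum_comm]
  refine Finset.sum_congr rfl fun Z _ => ?_
  rw [Finset.sum_comm, ← sum_shell]
  exact Finset.sum_congr rfl fun k _ => by simp

theorem shellInteraction_mem_localObs (J : Finset Λ → Obs Λ q) (Y : Finset Λ) :
    shellInteraction G J Y ∈ localObs Y := by
  refine sum_mem_localObs fun Z _ => sum_mem_localObs fun k _ => ?_
  split_ifs with h
  · exact h ▸ shell_mem_localObs Z (J Z) k
  · exact mem_localObs_iff.2 (map_zero (condExpCLM Y))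

theorem isSelfAdjoint_shellInteraction {J : Finset Λ → Obs Λ q} (hJ : ∀ Z, IsSelfAdjoint (J Z))
    (Y : Finset Λ) : IsSelfAdjoint (shellInteraction G J Y) := by
  refine isSelfAdjoint_sum (R := Obs Λ q) _ fun Z _ => isSelfAdjoint_sum (R := Obs Λ q) _
    fun k _ => ?_
  split_ifs with h
  · exact isSelfAdjoint_shell Z (hJ Z) k
  · exact IsSelfAdjoint.zero (Obs Λ q)

theorem sum_shellInteraction_le (J : Finset Λ → Obs Λ q) (w : Finset Λ → ℝ≥0∞) (z : Λ) :
    ∑ Y : Finset Λ with z ∈ Y, ‖shellInteraction G J Y‖ₑ * w Y ≤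
      ∑ k ∈ Finset.range (maxDist G + 1), ∑ Z : Finset Λ with z ∈ thickening G Z k,
        ‖shell G Z (J Z) k‖ₑ * w (thickening G Z k) := by
  have h1 : ∀ Y, ‖shellInteraction G J Y‖ₑ * w Y ≤ ∑ Z, ∑ k ∈ Finset.range (maxDist G + 1),
      if thickening G Z k = Y then ‖shell G Z (J Z) k‖ₑ * w (thickening G Z k) else 0 := fun Y => by
    have h2 : ‖shellInteraction G J Y‖ₑ ≤ ∑ Z, ∑ k ∈ Finset.range (maxDist G + 1),
        ‖if thickening G Z k = Y then shell G Z (J Z) k else 0‖ₑ :=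
      (enorm_sum_le_obs _ _).trans (Finset.sum_le_sum fun Z _ => enorm_sum_le_obs _ _)
    refine (mul_le_mul_left h2 (w Y)).trans_eq ?_
    rw [Finset.sum_mul]
    refine Finset.sum_congr rfl fun Z _ => ?_
    rw [Finset.sum_mul]
    refine Finset.sum_congr rfl fun k _ => ?_
    split_ifs with h
    · rw [h]
    · rw [enorm_zero_obs, zero_mul]
  refine (Finset.sum_le_sum fun Y _ => h1 Y).trans_eq ?_
  have h3 : ∀ k, ∑ Z : Finset Λ with z ∈ thickening G Z k,
      ‖shell G Z (J Z) k‖ₑ * w (thickening G Z k) = ∑ Z : Finset Λ,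
        if z ∈ thickening G Z k then ‖shell G Z (J Z) k‖ₑ * w (thickening G Z k) else 0 :=
    fun k => Finset.sum_filter _ _
  simp only [h3]
  rw [Finset.sum_comm, Finset.sum_comm (s := Finset.range _)]
  refine Finset.sum_congr rfl fun Z _ => ?_
  rw [Finset.sum_comm]
  refine Finset.sum_congr rfl fun k _ => ?_
  rw [Finset.sum_ite_eq]
  simp

/-- Summation over the sets whose thickening contains `z`. -/
theorem sum_thickening_le (f : Finset Λ → ℝ≥0∞) {S : ℝ≥0∞}
    (hS : ∀ x, ∑ Z : Finset Λ with x ∈ Z, f Z ≤ S) (z : Λ) (k : ℕ) :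
    ∑ Z : Finset Λ with z ∈ thickening G Z k, f Z ≤
      (Set.ncard {x : Λ | G.edist x z ≤ (k : ℕ∞)} : ℝ≥0∞) * S := by
  have hmem : ∀ x, x ∈ thickening G {z} k ↔ G.edist x z ≤ k := fun x => by simp [mem_thickening]
  have hcard : Set.ncard {x : Λ | G.edist x z ≤ (k : ℕ∞)} = (thickening G {z} k).card := by
    rw [← Set.ncard_coe_finset]
    congr 1
    ext x
    simp [hmem]
  rw [hcard]
  -- Each such `Z` meets the ball of radius `k` about `z`, so it is counted at least once when
  -- summing over the points of the ball.
  calc _ ≤ ∑ Z, ∑ x ∈ thickening G {z} k, if x ∈ Z then f Z else 0 := by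
        rw [Finset.sum_filter]
        refine Finset.sum_le_sum fun Z _ => ?_
        split_ifs with h
        · obtain ⟨x, hx, hzx⟩ := mem_thickening.1 h
          refine le_trans ?_ (Finset.single_le_sum (fun _ _ => zero_le)
            ((hmem x).2 (by rwa [G.edist_comm])))
          simp [hx]
        · exact zero_le
    _ = ∑ x ∈ thickening G {z} k, ∑ Z : Finset Λ with x ∈ Z, f Z := by
        rw [Finset.sum_comm]
        simp only [Finset.sum_filter]
    _ ≤ _ := by
        refine (Finset.sum_le_card_nsmul _ _ S fun x _ => hS x).trans_eq ?_
        rw [nsmul_eq_mul]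

theorem IsDecaying.sum_shellInteraction_le {D : ℕ} {Cvol : ℝ} (hG : InGraphClass G D Cvol)
    (hCvol : 0 < Cvol) (hΦ : IsDecaying G b' N Φ)
    (hK : IsVolumeConst G (b' - b) K) (hb : 0 ≤ b) (hbb' : b < b') (hN : 0 ≤ N) (hβ : 0 < β)
    (hr : 0 < r) (hrb : r ≤ b / 2) (hrv : 4 * v ^ 2 * r ≤ β ^ 2) (hv : b * v = 2 * (K * N))
    {A : Finset Λ → Obs Λ q} (hA : ∀ Z, A Z ∈ localObs Z) {S : ℝ≥0∞}
    (hS : ∀ x, ∑ Z : Finset Λ with x ∈ Z, ‖A Z‖ₑ * expWeight G b' Z ≤ S) (z : Λ)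
    (hc : c = Cvol * (D.factorial / (b' - b) ^ D * Real.exp (b' - b))) :
    ∑ Y : Finset Λ with z ∈ Y,
        ‖shellInteraction G (fun Z => filteredEvolution (∑ Z, Φ Z) β (A Z)) Y‖ₑ *
          expWeight G (r / 3) Y ≤
      ENNReal.ofReal (48 * Real.exp b * c * Cvol *
        (D.factorial * (Real.exp b * (1 + b)) * 12 ^ (D + 1)) * (r ^ (D + 1))⁻¹ * β⁻¹) * S := by
  have hbb : 0 < b' - b := sub_pos.2 hbb'
  have hc0 : 0 < c := by rw [hc]; positivity
  set d : ℕ → ℝ := fun k => 48 * Real.exp b * c / β * Real.exp (-(2 * (r / 12) * k)) with hd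
  have hd0 : ∀ k, 0 ≤ d k := fun k => by positivity
  have hterm : ∀ k, ∑ Z : Finset Λ with z ∈ thickening G Z k,
      ‖shell G Z (filteredEvolution (∑ Z, Φ Z) β (A Z)) k‖ₑ *
        expWeight G (r / 3) (thickening G Z k) ≤
      ENNReal.ofReal (Cvol * ((k : ℝ) + 1) ^ D * d k) * S := fun k => by
    calc _ ≤ ∑ Z : Finset Λ with z ∈ thickening G Z k,
          ENNReal.ofReal (d k) * (‖A Z‖ₑ * expWeight G b' Z) := by
          refine Finset.sum_le_sum fun Z hZ => ?_
          obtain ⟨x, hx, -⟩ := mem_thickening.1 (Finset.mem_filter.1 hZ).2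
          exact hΦ.enorm_shell_mul_expWeight_le hK hb hN hβ hr.le hrb hrv hv hc0 ⟨x, hx⟩
            (fun h => hc ▸ card_le_of_inGraphClass hG hCvol hbb h ⟨x, hx⟩) k (hA Z)
      _ ≤ ENNReal.ofReal (d k) *
          ((Set.ncard {x : Λ | G.edist x z ≤ (k : ℕ∞)} : ℝ≥0∞) * S) := by
          rw [← Finset.mul_sum]
          gcongr
          exact sum_thickening_le _ hS z k
      _ ≤ ENNReal.ofReal (d k) * (ENNReal.ofReal (Cvol * ((k : ℝ) + 1) ^ D) * S) := by
          gcongr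
          rw [← ENNReal.ofReal_natCast]
          exact ENNReal.ofReal_le_ofReal (hG z k)
      _ = _ := by
          rw [← mul_assoc, ← ENNReal.ofReal_mul (hd0 k), mul_comm (d k)]
  refine (SpinLattice.sum_shellInteraction_le _ _ z).trans
    ((Finset.sum_le_sum fun k _ => hterm k).trans ?_)
  rw [← Finset.sum_mul, ← ENNReal.ofReal_sum_of_nonneg fun k _ => by
    have := hd0 k
    positivity]
  gcongr
  -- The rate `r / 12` produces the factor `12 ^ (D + 1)` in the constant.
  have hsum := sum_pow_mul_exp_le D (maxDist G + 1) (r := r / 12) (R := b) (by positivity)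
    (by linarith)
  calc _ = 48 * Real.exp b * c / β * Cvol * ∑ k ∈ Finset.range (maxDist G + 1),
        ((k : ℝ) + 1) ^ D * Real.exp (-(2 * (r / 12) * k)) := by
        rw [Finset.mul_sum]
        refine Finset.sum_congr rfl fun k _ => ?_
        simp only [hd]
        ring
    _ ≤ 48 * Real.exp b * c / β * Cvol *
        (D.factorial * (Real.exp b * (1 + b)) * ((r / 12) ^ (D + 1))⁻¹) := by gcongr
    _ = _ := by
        rw [div_pow]
        field_simp

theorem decayRate_spec (hb : 0 < b) (hβ : 0 < β) :
    0 < decayRate b v β ∧ decayRate b v β ≤ b / 2 ∧ 4 * v ^ 2 * decayRate b v β ≤ β ^ 2 := by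
  unfold decayRate
  split_ifs with h
  · exact ⟨by positivity, le_rfl, by rw [h]; simpa using sq_nonneg β⟩
  · refine ⟨lt_min (by positivity) (by positivity), min_le_left _ _, ?_⟩
    have h1 : 0 < 4 * v ^ 2 := by positivity
    rw [mul_comm, ← le_div_iff₀ h1]
    exact min_le_right _ _

end Interactions

end

end SpinLattice

/-! ### The theorem -/

theorem mainTheorem7 (D : ℕ) (Cvol b b' : ℝ) (hCvol : 0 < Cvol)
    (hb : 0 < b) (hbb' : b < b') (hb'D : b' < D) :
    ∃ C : ℝ, 0 < C ∧
      ∀ (Λ : Type*) [Fintype Λ] [DecidableEq Λ] (G : SimpleGraph Λ),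
        SpinLattice.InGraphClass G D Cvol →
      ∀ (K : ℝ), SpinLattice.IsVolumeConst G (b' - b) K →
      ∀ (q : ℕ), 0 < q → ∀ (β : ℝ), 0 < β →
      ∀ (t₀ t₁ : ℝ), t₀ < t₁ →
      ∀ (Φ : ℝ → Finset Λ → SpinLattice.Obs Λ q),
        SpinLattice.IsInteraction (Set.Icc t₀ t₁) Φ →
        (∀ Z, ContDiffOn ℝ ∞ (fun t => Φ t Z) (Set.Icc t₀ t₁)) →
        SpinLattice.interactionNorm G (Set.Icc t₀ t₁) b' Φ < ⊤ →
        SpinLattice.interactionNorm G (Set.Icc t₀ t₁) b'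
          (SpinLattice.timeDeriv (Set.Icc t₀ t₁) Φ) < ⊤ →
      ∀ (v bβ : ℝ),
        v = SpinLattice.lrVelocity K b (SpinLattice.interactionNorm G (Set.Icc t₀ t₁) b' Φ) →
        bβ = SpinLattice.decayRate b v β →
      ∃ Ψ : ℝ → Finset Λ → SpinLattice.Obs Λ q,
        SpinLattice.IsInteraction (Set.Icc t₀ t₁) Ψ ∧
        (∀ t ∈ Set.Icc t₀ t₁,
          SpinLattice.almostInverseLiouvillian (SpinLattice.hamiltonian Φ t) β
              (derivWithin (SpinLattice.hamiltonian Φ) (Set.Icc t₀ t₁) t)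
            = SpinLattice.hamiltonian Ψ t) ∧
        SpinLattice.interactionNorm G (Set.Icc t₀ t₁) (bβ / 3) Ψ
          ≤ ENNReal.ofReal (SpinLattice.prefactor C D bβ β) *
            SpinLattice.interactionNorm G (Set.Icc t₀ t₁) b'
              (SpinLattice.timeDeriv (Set.Icc t₀ t₁) Φ) ∧
        (SpinLattice.interactionNorm G (Set.Icc t₀ t₁) b'
            (SpinLattice.timeDeriv (Set.Icc t₀ t₁) Φ) ≠ 0 →
          SpinLattice.interactionNorm G (Set.Icc t₀ t₁) (bβ / 3) Ψ
            < ENNReal.ofReal (SpinLattice.prefactor C D bβ β) *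
              SpinLattice.interactionNorm G (Set.Icc t₀ t₁) b'
                (SpinLattice.timeDeriv (Set.Icc t₀ t₁) Φ)) := by
  have hbb : 0 < b' - b := sub_pos.2 hbb'
  set c : ℝ := Cvol * (D.factorial / (b' - b) ^ D * Real.exp (b' - b)) with hc
  set C : ℝ := 48 * Real.exp b * c * Cvol *
    (D.factorial * (Real.exp b * (1 + b)) * 12 ^ (D + 1)) with hC
  refine ⟨C, by positivity, ?_⟩
  intro Λ _ _ G hG K hK q hq β hβ t₀ t₁ ht Φ hΦ hsmooth hfin hfin' v r hv hr
  have : NeZero q := ⟨hq.ne'⟩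
  set I := Set.Icc t₀ t₁ with hI
  have hd : ∀ Z, DifferentiableOn ℝ (fun t => Φ t Z) I := fun Z =>
    (hsmooth Z).differentiableOn (by simp)
  have hΦ' : SpinLattice.IsInteraction I (SpinLattice.timeDeriv I Φ) :=
    hΦ.timeDeriv (uniqueDiffOn_Icc ht) hd
  obtain ⟨hr0, hrb, hrv⟩ := SpinLattice.decayRate_spec (v := v) hb hβ
  rw [← hr] at hr0 hrb hrv
  set N := SpinLattice.interactionNorm G I b' Φ with hN
  set S := SpinLattice.interactionNorm G I b' (SpinLattice.timeDeriv I Φ) with hS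
  -- This identifies `b v` with the growth rate `2 κ` of the Lieb-Robinson bound.
  have hv' : b * v = 2 * (K * N.toReal) := by
    rw [hv, SpinLattice.lrVelocity]
    field_simp
  have hN0 : 0 ≤ N.toReal := ENNReal.toReal_nonneg
  have hdec : ∀ t ∈ I, SpinLattice.IsDecaying G b' N.toReal (Φ t) := fun t ht =>
    hΦ.isDecaying hfin ht
  have hle : SpinLattice.interactionNorm G I (r / 3) (fun t => SpinLattice.shellInteraction G
      fun Z => SpinLattice.filteredEvolution (∑ Z, Φ t Z) β (SpinLattice.timeDeriv I Φ t Z)) ≤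
      ENNReal.ofReal (C * (r ^ (D + 1))⁻¹ * β⁻¹) * S :=
    iSup₂_le fun t ht => iSup_le fun z =>
      (hdec t ht).sum_shellInteraction_le hG hCvol hK hb.le hbb' hN0 hβ hr0 hrb hrv hv'
        (fun Z => (hΦ' t ht Z).1) (fun x => SpinLattice.sum_le_interactionNorm ht x) z hc
  -- The estimate uses only the `1 / β` part of the prefactor; the unused `1` and the `β` part make
  -- the final inequality strict.
  have hpre : C * (r ^ (D + 1))⁻¹ * β⁻¹ < SpinLattice.prefactor C D r β := by
    have h1 : 0 < C * (r ^ (D + 1))⁻¹ * β := by positivity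
    rw [SpinLattice.prefactor, mul_add]
    linarith
  refine ⟨_, fun t ht Z => ⟨SpinLattice.shellInteraction_mem_localObs _ Z,
    SpinLattice.isSelfAdjoint_shellInteraction (fun Z =>
      SpinLattice.isSelfAdjoint_filteredEvolution (𝔄 := SpinLattice.Obs Λ q)
        (hdec t ht).isSelfAdjoint_sum (hΦ' t ht Z).2 hβ) Z⟩, fun t ht => ?_,
    hle.trans (mul_le_mul_left (ENNReal.ofReal_le_ofReal hpre.le) S), fun hS0 => hle.trans_lt ?_⟩
  · rw [SpinLattice.derivWithin_hamiltonian hd ht, SpinLattice.hamiltonian,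
      SpinLattice.hamiltonian, SpinLattice.sum_shellInteraction]
    refine (SpinLattice.filteredEvolution_sum (𝔄 := SpinLattice.Obs Λ q)
      (hdec t ht).isSelfAdjoint_sum hβ _ _).trans (Finset.sum_congr rfl fun Z _ => ?_)
    exact ((hdec t ht).condExp_maxDist hK hb.le hN0 hβ hr0 hrb hrv hv' (hΦ' t ht Z).1).symm
  · refine ENNReal.mul_lt_mul_left hS0 hfin'.ne ?_
    exact (ENNReal.ofReal_lt_ofReal_iff_of_nonneg (by positivity)).2 hpre
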